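/- Conventions. A set $Y$ with a symmetric distance function $d$ is (Gromov-)hyperbolic if there is $\delta$ with $(x|z)_w\ge\min\{(x|y)_w,(y|z)_w\}-\delta$ for all $w,x,y,z$, where $2(x|y)_w=d(w,x)+d(w,y)-d(x,y)$. The boundary $\partial X$ of a hyperbolic space $X$ is the set of sequences $(u_n)$ with $(u_n|u_m)_w\to\infty$, two sequences being identified when $(u_n|v_n)_w\to\infty$. For $\xi\in\partial X$, a horokernel at $\xi$ is any accumulation point, for pointwise convergence, of the functions $(x,y)\mapsto d(x,u_n)-d(y,u_n)$ with $(u_n)$ representing $\xi$. If $\Gamma$ acts isometrically on $X$ and fixes $\xi$, its Busemann quasicharacter is $\beta_\xi(g)=\lim_n\frac1n h(x,g^nx)$, which depends neither on the horokernel $h$ at $\xi$ nor on $x\in X$. The action is focal if $\Gamma$ fixes a unique point $\xi\in\partial X$ and some $g\in\Gamma$ is hyperbolic, i.e. $\lim_n\frac1n d(x,g^nx)>0$; it is regular focal if moreover $\beta_\xi$ is a homomorphism. An automorphism $\alpha$ of a group $H$ is confining into $A\subset H$ if $\alpha(A)\subset A$, $H=\bigcup_{n\ge0}\alpha^{-n}(A)$,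 and $\alpha^{n_0}(A\cdot A)\subset A$ for some $n_0\ge0$; it is strictly confining if moreover $\alpha(A)\ne A$. On $H\rtimes\langle\alpha\rangle$, where $\langle\alpha\rangle$ is infinite cyclic, $d_S$ denotes the word metric of the generating set $S=A\cup\{\alpha^{\pm1}\}$. For $x\in X$, set $d_x(g,g')=d(gx,g'x)$ on $\Gamma$. Theorem. Let $\Gamma$ be a group with a cobounded isometric action on a nonempty geodesic metric space $X$. The following are equivalent. (1) $X$ is hyperbolic and the $\Gamma$-action is regular focal. (2) There exist $\alpha\in\Gamma$ and a symmetric subset $A=A^{-1}\subset[\Gamma,\Gamma]$ such that the image of $\alpha$ in $\Gamma/[\Gamma,\Gamma]$ has infinite order; the action of $\alpha$ on $[\Gamma,\Gamma]$ by conjugation $h\mapsto\alpha h\alpha^{-1}$ is strictly confining into $A$; and, with $G=[\Gamma,\Gamma]\rtimes\langle\alpha\rangle$ and $S=A\cup\{\alpha^{\pm1}\}$, the inclusion $(G,d_S)\to(\Gamma,d_x)$ is a quasi-isometry for some $x\in X$. Moreover, for all $\alpha$ and $A$ as in (2), the inclusion $(G,d_S)\to(\Gamma,d_x)$ is a quasi-isometry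 for every $x\in X$, and the Busemann character of (1) is proportional, in restriction to $G$, to the projection $G\to\mathbf{Z}$: there is $c\neq0$ with $\beta_\xi(h\alpha^n)=cn$ for all $h\in[\Gamma,\Gamma]$ and $n\in\mathbf{Z}$. Finally, for every group $H$ and every automorphism $\alpha$ of $H$ that is confining (strictly or not) into some symmetric subset $A=A^{-1}\subset H$, the group $H\rtimes\langle\alpha\rangle$ with the word metric $d_S$ of $S=A\cup\{\alpha^{\pm1}\}$ is Gromov-hyperbolic. -/

import Mathlib

open Filter Topology

universe u v w

/-! ### Distances, hyperbolicity, quasi-isometries -/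

/-- The Gromov product `(y|z)_w` of a distance function `d`. -/
noncomputable def gromovProduct {Y : Type*} (d : Y → Y → ℝ) (w y z : Y) : ℝ :=
  (d w y + d w z - d y z) / 2

/-- Gromov hyperbolicity (four-point condition) of a set with a distance function. -/
def IsGromovHyperbolic {Y : Type*} (d : Y → Y → ℝ) : Prop :=
  ∃ δ : ℝ, ∀ w x y z : Y,
    min (gromovProduct d w x y) (gromovProduct d w y z) - δ ≤ gromovProduct d w x z

/-- `f : (Y, dY) → (Z, dZ)` is a quasi-isometry: a quasi-isometric embedding with coarsely
dense image. -/
def IsQuasiIsometry {Y Z : Type*} (dY : Y → Y → ℝ) (dZ : Z → Z → ℝ) (f : Y → Z) : Prop :=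
  ∃ C : ℝ, 1 ≤ C ∧
    (∀ y y' : Y, C⁻¹ * dY y y' - C ≤ dZ (f y) (f y') ∧ dZ (f y) (f y') ≤ C * dY y y' + C) ∧
    ∀ z : Z, ∃ y : Y, dZ (f y) z ≤ C

/-- Any two points are joined by a geodesic segment. -/
def IsGeodesicSpace (X : Type*) [MetricSpace X] : Prop :=
  ∀ x y : X, ∃ γ : ℝ → X, γ 0 = x ∧ γ (dist x y) = y ∧
    ∀ s ∈ Set.Icc (0 : ℝ) (dist x y), ∀ t ∈ Set.Icc (0 : ℝ) (dist x y),
      dist (γ s) (γ t) = |s - t|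

/-! ### The visual boundary -/

/-- Cauchy-Gromov sequences: `(u_n|u_m)_w → ∞` as `n, m → ∞`. -/
def IsCauchyGromov {X : Type*} [MetricSpace X] (u : ℕ → X) : Prop :=
  ∀ w : X, Tendsto (fun p : ℕ × ℕ => gromovProduct dist w (u p.1) (u p.2)) atTop atTop

/-- Two Cauchy-Gromov sequences are identified when `(u_n|v_n)_w → ∞`. -/
def CauchyGromovRel (X : Type*) [MetricSpace X] (u v : {u : ℕ → X // IsCauchyGromov u}) : Prop :=
  ∀ w : X, Tendsto (fun n : ℕ => gromovProduct dist w (u.1 n) (v.1 n)) atTop atTop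

/-- The visual boundary; `CauchyGromovRel` is an equivalence relation when `X` is hyperbolic. -/
def VisualBoundary (X : Type*) [MetricSpace X] : Type _ :=
  Quot (CauchyGromovRel X)

section Action

variable {Γ : Type*} [Group Γ] {X : Type*} [MetricSpace X] [MulAction Γ X] [IsIsometricSMul Γ X]

theorem gromovProduct_smul (g : Γ) (w y z : X) :
    gromovProduct dist w (g • y) (g • z) = gromovProduct dist (g⁻¹ • w) y z := by
  have h (a : X) : dist w (g • a) = dist (g⁻¹ • w) a := by
    rw [← dist_smul g (g⁻¹ • w) a, smul_inv_smul]
  simp only [gromovProduct, h, dist_smul]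

theorem IsCauchyGromov.smul (g : Γ) {u : ℕ → X} (hu : IsCauchyGromov u) :
    IsCauchyGromov (fun n => g • u n) := by
  intro w
  simpa only [gromovProduct_smul] using hu (g⁻¹ • w)

/-- The action of the group on the visual boundary. -/
instance : SMul Γ (VisualBoundary X) where
  smul g := Quot.map (fun u => ⟨fun n => g • u.1 n, u.2.smul g⟩) (by
    intro u v huv w
    simpa only [gromovProduct_smul] using huv (g⁻¹ • w))

end Action

/-! ### Horokernels, the Busemann quasicharacter, focal actions -/

/-- Horokernels based at `ξ`: the accumulation points, for pointwise convergence, of the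
functions `(x, y) ↦ d(x, u_n) - d(y, u_n)`, where `(u_n)` represents `ξ`. -/
def horokernels {X : Type*} [MetricSpace X] (ξ : VisualBoundary X) : Set (X × X → ℝ) :=
  {h | ∃ u : {u : ℕ → X // IsCauchyGromov u}, Quot.mk (CauchyGromovRel X) u = ξ ∧
    MapClusterPt h atTop (fun (n : ℕ) (p : X × X) => dist p.1 (u.1 n) - dist p.2 (u.1 n))}

/-- `β` is the Busemann quasicharacter at the point `ξ` fixed by `Γ`:
`β g = lim h(x, g ^ n x) / n`, for every horokernel `h` based at `ξ` and every point `x`.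
(The set of horokernels is never empty, by Tychonoff, so `β` is unique when `X` is nonempty.) -/
def IsBusemannQuasicharacter {Γ : Type*} [Group Γ] {X : Type*} [MetricSpace X] [MulAction Γ X]
    (ξ : VisualBoundary X) (β : Γ → ℝ) : Prop :=
  ∀ h ∈ horokernels ξ, ∀ (x : X) (g : Γ),
    Tendsto (fun n : ℕ => h (x, g ^ n • x) / (n : ℝ)) atTop (𝓝 (β g))

/-- `g` acts as a hyperbolic isometry: `lim d(x, g ^ n x) / n` is positive. -/
def IsHyperbolicIsometry {Γ : Type*} [Group Γ] (X : Type*) [MetricSpace X] [MulAction Γ X]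
    (g : Γ) : Prop :=
  ∃ l : ℝ, 0 < l ∧ ∀ x : X, Tendsto (fun n : ℕ => dist x (g ^ n • x) / (n : ℝ)) atTop (𝓝 l)

/-- The action is focal with `ξ` as its unique fixed boundary point. -/
def IsFocalAt (Γ : Type*) [Group Γ] {X : Type*} [MetricSpace X] [MulAction Γ X]
    [IsIsometricSMul Γ X] (ξ : VisualBoundary X) : Prop :=
  (∀ g : Γ, g • ξ = ξ) ∧ (∀ η : VisualBoundary X, (∀ g : Γ, g • η = η) → η = ξ) ∧
    ∃ g : Γ, IsHyperbolicIsometry X g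

/-- The action is regular focal: it is focal and its Busemann quasicharacter is a homomorphism. -/
def IsRegularFocal (Γ : Type*) [Group Γ] (X : Type*) [MetricSpace X] [MulAction Γ X]
    [IsIsometricSMul Γ X] : Prop :=
  ∃ ξ : VisualBoundary X, IsFocalAt Γ ξ ∧
    ∃ β : Γ → ℝ, IsBusemannQuasicharacter ξ β ∧ ∀ g g' : Γ, β (g * g') = β g + β g'

/-- The action is cobounded: some orbit is coarsely dense. -/
def IsCoboundedAction (Γ : Type*) [Group Γ] (X : Type*) [MetricSpace X] [MulAction Γ X] : Prop :=
  ∃ (x : X) (R : ℝ), ∀ y : X, ∃ g : Γ, dist y (g • x) ≤ R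

/-- The pseudometric `d_x(g, g') = d(g x, g' x)` on the group. -/
def orbitDist {Γ : Type*} [Group Γ] {X : Type*} [MetricSpace X] [MulAction Γ X]
    (x : X) (g g' : Γ) : ℝ :=
  dist (g • x) (g' • x)

/-! ### Word metrics and confining automorphisms -/

/-- The word length of `g`: the least length of a word in `S` and its inverses with product `g`
(used only for sets `S` that generate the group). -/
noncomputable def wordLength {G : Type*} [Group G] (S : Set G) (g : G) : ℕ :=
  sInf {n : ℕ | ∃ l : List G, l.length = n ∧ (∀ s ∈ l, s ∈ S ∨ s⁻¹ ∈ S) ∧ l.prod = g}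

/-- The left-invariant word metric of a generating set `S`. -/
noncomputable def wordDist {G : Type*} [Group G] (S : Set G) (g g' : G) : ℝ :=
  wordLength S (g⁻¹ * g')

/-- The automorphism `α` of `H` is confining into the subset `A`. -/
def IsConfining {H : Type*} [Group H] (α : MulAut H) (A : Set H) : Prop :=
  α '' A ⊆ A ∧ (∀ h : H, ∃ n : ℕ, (α ^ n) h ∈ A) ∧
    ∃ n₀ : ℕ, ∀ a ∈ A, ∀ b ∈ A, (α ^ n₀) (a * b) ∈ A

/-- The automorphism `α` of `H` is strictly confining into the subset `A`. -/
def IsStrictlyConfining {H : Type*} [Group H] (α : MulAut H) (A : Set H) : Prop :=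
  IsConfining α A ∧ α '' A ≠ A

/-- The semidirect product `H ⋊ ℤ`, where the generator of `ℤ` acts on `H` by `α`. -/
abbrev CyclicExtension {H : Type*} [Group H] (α : MulAut H) : Type _ :=
  H ⋊[zpowersHom (MulAut H) α] Multiplicative ℤ

/-- The subset `A ∪ {α, α⁻¹}` of `H ⋊ ⟨α⟩`. -/
def confiningGenerators {H : Type*} [Group H] (α : MulAut H) (A : Set H) :
    Set (CyclicExtension α) :=
  SemidirectProduct.inl '' A ∪
    {SemidirectProduct.inr (Multiplicative.ofAdd 1),
      SemidirectProduct.inr (Multiplicative.ofAdd (-1))}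

/-- The homomorphism `[Γ, Γ] ⋊ ⟨α⟩ → Γ`, `(h, n) ↦ h * α ^ n`; it is the inclusion of the subgroup
`[Γ, Γ]⟨α⟩` when `α` has infinite order in the abelianization. -/
def commutatorExtensionHom {Γ : Type*} [Group Γ] (α : Γ) :
    CyclicExtension (MulAut.conjNormal α : MulAut (commutator Γ)) →* Γ :=
  SemidirectProduct.lift (commutator Γ).subtype (zpowersHom Γ α) (by
    intro n
    ext h
    simp [zpowersHom_apply, ← map_zpow, MulAut.conjNormal_apply])

/-- The inclusion `([Γ, Γ] ⋊ ⟨α⟩, d_S) → (Γ, d_x)`, with `S = A ∪ {α, α⁻¹}`, is a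
quasi-isometry. -/
def InclusionIsQuasiIsometry {Γ : Type*} [Group Γ] {X : Type*} [MetricSpace X] [MulAction Γ X]
    (α : Γ) (A : Set (commutator Γ)) (x : X) : Prop :=
  IsQuasiIsometry
    (wordDist (confiningGenerators (MulAut.conjNormal α : MulAut (commutator Γ)) A))
    (orbitDist x) (commutatorExtensionHom α)

/-- The group-theoretic description of the action: `α` has infinite order in the abelianization,
acts by conjugation on `[Γ, Γ]` as a strictly confining automorphism into the symmetric subset
`A`, and `[Γ, Γ] ⋊ ⟨α⟩` with its word metric is quasi-isometric to `Γ` through the inclusion. -/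
def IsConfiningPair {Γ : Type*} [Group Γ] (X : Type*) [MetricSpace X] [MulAction Γ X]
    (α : Γ) (A : Set (commutator Γ)) : Prop :=
  ¬ IsOfFinOrder (Abelianization.of α) ∧
    (∀ a ∈ A, a⁻¹ ∈ A) ∧
    IsStrictlyConfining (MulAut.conjNormal α : MulAut (commutator Γ)) A ∧
    ∃ x : X, InclusionIsQuasiIsometry α A x

/-! From (1) to (2). A horokernel `h` at the fixed point `ξ` is `Γ`-invariant up to a bounded error,
and `β` vanishes on commutators, so commutators preserve horospheres coarsely. The displacement of
such an element decreases at speed 2 along a ray to `ξ`, until it reaches a universal constant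
(`IsQuasiHorofunction.dist_pow_smul_le`). If `s` translates towards `ξ`, conjugation by a large
power of `s⁻¹` is therefore confining into the set `A` of commutators moving `x` by at most this
constant. If it were not strictly confining, `[Γ, Γ]` would have bounded orbits and the repelling
point of `s` would be a second fixed point. The quasi-isometry comes from a Švarc–Milnor argument.

From (2) to (1). On `H ⋊ ⟨α⟩`, the level of two elements is the height, up to sign, at which their
vertical rays merge. It is ultrametric up to an additive error because `α ^ n₀` sends `A * A` into
`A`; hence height plus height plus twice the level is a hyperbolic model distance. It differs from
`d_S` by a bounded amount: a product of `m` letters of `A` raises the level by `O(log m)` only,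
while it costs `m` letters (`IsConfining.exists_modelDist_le`). This gives the last assertion, with
no strictness needed.

The quasi-isometry with `X` is then upgraded to an additive comparison. A geodesic of `X` is a
quasigeodesic of `d_S`, so the vertical paths of the model pass near it and distances in `X` are
almost additive along them. Thus orbit distances are `l * modelDist` up to a constant, `l` being the
translation length of `α` (`exists_abs_dist_sub_modelDist_le`), and the four-point inequality passes
to `X`. The points `α ^ (-n) x` converge to a point `ξ`. It is fixed, because the commutators of a
given `g` with the powers of `α` have bounded displacement. It is the only fixed point, because each
commutator coarsely fixes the far points of the ray while strictness makes the orbits of `[Γ, Γ]`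
unbounded. The same coarse fixing bounds `h` on `[Γ, Γ]`, which makes the homogeneous quasicharacter
`β` a homomorphism. -/

/-! ### Auxiliary facts on pseudodistances and Gromov products -/

/-- A real-valued pseudodistance on a set. -/
structure IsPseudoDist {Y : Type*} (d : Y → Y → ℝ) : Prop where
  self : ∀ x, d x x = 0
  symm : ∀ x y, d x y = d y x
  triangle : ∀ x y z, d x z ≤ d x y + d y z

theorem IsPseudoDist.nonneg {Y : Type*} {d : Y → Y → ℝ} (h : IsPseudoDist d) (x y : Y) :
    0 ≤ d x y := by
  have := h.triangle x y x
  rw [h.self, h.symm y x] at this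
  linarith

theorem isPseudoDist_dist {X : Type*} [MetricSpace X] : IsPseudoDist (dist : X → X → ℝ) :=
  ⟨dist_self, dist_comm, dist_triangle⟩

theorem gromovProduct_comm {Y : Type*} {d : Y → Y → ℝ} (h : IsPseudoDist d) (w x y : Y) :
    gromovProduct d w x y = gromovProduct d w y x := by
  simp only [gromovProduct, h.symm x y]; ring

/-- The Gromov product inequality with constant `δ`. -/
def FourPoint {Y : Type*} (d : Y → Y → ℝ) (δ : ℝ) : Prop :=
  ∀ w x y z : Y, min (gromovProduct d w x y) (gromovProduct d w y z) - δ ≤ gromovProduct d w x z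

theorem FourPoint.nonneg {Y : Type*} [Nonempty Y] {d : Y → Y → ℝ} {δ : ℝ} (h : FourPoint d δ) :
    0 ≤ δ := by
  obtain ⟨y⟩ := ‹Nonempty Y›
  have := h y y y y
  simp only [min_self] at this
  linarith

theorem FourPoint.le_max {Y : Type*} {d : Y → Y → ℝ} {δ : ℝ}
    (h : FourPoint d δ) (w x y z : Y) :
    d x z + d w y ≤ max (d x y + d w z) (d w x + d y z) + 2 * δ := by
  have h1 := h w x y z
  simp only [gromovProduct] at h1
  rcases min_cases ((d w x + d w y - d x y) / 2) ((d w y + d w z - d y z) / 2) with ⟨h2, -⟩ | ⟨h2, -⟩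
  · have := le_max_left (d x y + d w z) (d w x + d y z)
    linarith
  · have := le_max_right (d x y + d w z) (d w x + d y z)
    linarith

theorem fourPoint_of_le_max {Y : Type*} {d : Y → Y → ℝ} {δ : ℝ}
    (h : ∀ w x y z : Y, d x z + d w y ≤ max (d x y + d w z) (d w x + d y z) + 2 * δ) :
    FourPoint d δ := by
  intro w x y z
  have h1 := h w x y z
  simp only [gromovProduct]
  rcases max_cases (d x y + d w z) (d w x + d y z) with ⟨h2, -⟩ | ⟨h2, -⟩
  · have := min_le_left ((d w x + d w y - d x y) / 2) ((d w y + d w z - d y z) / 2)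
    linarith
  · have := min_le_right ((d w x + d w y - d x y) / 2) ((d w y + d w z - d y z) / 2)
    linarith

/-! ### Quasi-additive sequences -/

/-- Fekete's lemma applies to `q + C`, which is subadditive. Comparing `q (k * n)` with `k * q n`
and letting `k` grow bounds the distance to the linear function by the same `C`. -/
theorem exists_slope_of_quasiAdditive {q : ℕ → ℝ} {C : ℝ}
    (h : ∀ m n, |q (m + n) - q m - q n| ≤ C) : ∃ l : ℝ, ∀ n : ℕ, |q n - n * l| ≤ C := by
  have hC : 0 ≤ C := (abs_nonneg _).trans (h 0 0)
  have hsub : Subadditive (fun n => q n + C) := by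
    intro m n
    have := abs_le.1 (h m n)
    simp only
    linarith
  have key : ∀ m n : ℕ, n * (q m - C) ≤ q (n * m) + C * 1 ∧ q (n * m) ≤ n * (q m + C) + C := by
    intro m n
    induction n with
    | zero =>
      have := abs_le.1 (h 0 0)
      simp at this ⊢
      constructor <;> linarith
    | succ n ih =>
      have := abs_le.1 (h (n * m) m)
      rw [Nat.succ_mul]
      push_cast
      constructor <;> linarith
  -- Compare the two estimates of `q (m * n)`, by multiples of `q m` and of `q n`; with `m = 1` this
  -- gives the lower bound that Fekete's lemma requires.
  have hlow : ∀ m n : ℕ, 0 < n → 0 < m → (q m - C) / m - 3 * C / n ≤ (q n + C) / n := by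
    intro m n hn hm
    have h1 := (key m n).1
    have h2 := (key n m).2
    rw [mul_comm m n] at h2
    have hn' : (0 : ℝ) < n := by exact_mod_cast hn
    have hm' : (0 : ℝ) < m := by exact_mod_cast hm
    have hm1 : (1 : ℝ) ≤ m := by exact_mod_cast hm
    rw [div_sub_div _ _ hm'.ne' hn'.ne', div_le_div_iff₀ (by positivity) hn']
    have : (q m - C) * n - m * (3 * C) ≤ (q n + C) * m := by nlinarith
    nlinarith
  have hbdd : BddBelow (Set.range fun n : ℕ => (q n + C) / n) := by
    refine ⟨min 0 (q 1 - C - 3 * C), ?_⟩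
    rintro _ ⟨n, rfl⟩
    rcases Nat.eq_zero_or_pos n with rfl | hn
    · simp
    · have := hlow 1 n hn one_pos
      have hn' : (1 : ℝ) ≤ n := by exact_mod_cast hn
      have h3 : 3 * C / n ≤ 3 * C := div_le_self (by linarith) hn'
      refine (min_le_right _ _).trans ?_
      simp only [Nat.cast_one, div_one] at this
      linarith
  have hlim := hsub.tendsto_lim hbdd
  refine ⟨hsub.lim, fun n => ?_⟩
  rcases Nat.eq_zero_or_pos n with rfl | hn
  · have := abs_le.1 (h 0 0)
    simp at this ⊢
    rw [abs_le]; constructor <;> linarith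
  have hn' : (0 : ℝ) < n := by exact_mod_cast hn
  have h1 : Tendsto (fun k : ℕ => (q (k * n) + C) / ((k * n : ℕ) : ℝ)) atTop (𝓝 hsub.lim) :=
    hlim.comp (tendsto_id.atTop_mul_const' hn)
  have h0 : Tendsto (fun k : ℕ => C / (k * n : ℝ)) atTop (𝓝 0) :=
    Tendsto.div_atTop tendsto_const_nhds (tendsto_natCast_atTop_atTop.atTop_mul_const hn')
  have hle : hsub.lim ≤ (q n + C) / n := by
    have h2 : Tendsto (fun k : ℕ => (q n + C) / n + 2 * (C / (k * n : ℝ))) atTop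
        (𝓝 ((q n + C) / n + 2 * 0)) := (h0.const_mul 2).const_add _
    rw [mul_zero, add_zero] at h2
    refine le_of_tendsto_of_tendsto h1 h2 ?_
    filter_upwards [eventually_gt_atTop 0] with k hk
    have hk' : (0 : ℝ) < k := by exact_mod_cast hk
    have := (key n k).2
    rw [Nat.cast_mul, div_le_iff₀ (by positivity)]
    field_simp
    linarith
  have hge : (q n - C) / n ≤ hsub.lim := by
    refine le_of_tendsto_of_tendsto tendsto_const_nhds h1 ?_
    filter_upwards [eventually_gt_atTop 0] with k hk
    have hk' : (0 : ℝ) < k := by exact_mod_cast hk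
    have := (key n k).1
    rw [Nat.cast_mul, le_div_iff₀ (by positivity)]
    field_simp
    linarith
  rw [le_div_iff₀ hn'] at hle
  rw [div_le_iff₀ hn'] at hge
  rw [abs_le]; constructor <;> linarith

theorem tendsto_div_of_abs_sub_le {q : ℕ → ℝ} {C l : ℝ} (h : ∀ n : ℕ, |q n - n * l| ≤ C) :
    Tendsto (fun n : ℕ => q n / n) atTop (𝓝 l) := by
  have h0 : Tendsto (fun n : ℕ => C / (n : ℝ)) atTop (𝓝 0) :=
    tendsto_const_nhds.div_atTop tendsto_natCast_atTop_atTop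
  refine tendsto_iff_norm_sub_tendsto_zero.2 (squeeze_zero' (.of_forall fun _ => norm_nonneg _) ?_ h0)
  filter_upwards [eventually_gt_atTop 0] with n hn
  have hn' : (0 : ℝ) < n := by exact_mod_cast hn
  have : q n / n - l = (q n - n * l) / n := by field_simp
  rw [this, Real.norm_eq_abs, abs_div, abs_of_pos hn']
  gcongr
  exact h n

/-! ### Rough geodesics are close to quasigeodesics with the same endpoints -/

theorem sq_le_four_mul_two_pow (L : ℕ) : ((L : ℝ) + 1) ^ 2 ≤ 4 * 2 ^ L := by
  induction L with
  | zero => norm_num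
  | succ L ih =>
    rcases Nat.lt_or_ge L 2 with h | h
    · interval_cases L <;> norm_num
    · have h' : (2 : ℝ) ≤ L := by exact_mod_cast h
      rw [pow_succ 2 L]; push_cast; nlinarith

theorem two_pow_clog_le (n : ℕ) : 2 ^ Nat.clog 2 n ≤ 2 * n + 1 := by
  rcases Nat.lt_or_ge 1 n with h1 | h1
  · have := Nat.pow_pred_clog_lt_self one_lt_two h1
    have h3 : Nat.clog 2 n = (Nat.clog 2 n).pred + 1 :=
      (Nat.succ_pred_eq_of_pos (Nat.clog_pos one_lt_two h1)).symm
    rw [h3, pow_succ]; omega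
  · rw [Nat.clog_of_right_le_one h1]; simp

theorem exists_bound_of_two_pow_le (P Q : ℝ) : ∃ L₀ : ℝ, ∀ L : ℕ, (2 : ℝ) ^ L ≤ P + Q * L → L ≤ L₀ := by
  refine ⟨4 * |P| + 4 * |Q| + 1, fun L hL => ?_⟩
  have h1 := sq_le_four_mul_two_pow L
  have hP := le_abs_self P
  have hQ := le_abs_self Q
  have hP0 := abs_nonneg P
  have hQ0 := abs_nonneg Q
  have hL0 : (0 : ℝ) ≤ L := by positivity
  by_contra! hcon
  nlinarith

/-- Bisect the path: each halving costs `δ`, so the total loss is logarithmic in the number of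
steps. -/
theorem FourPoint.chain {Y : Type*} {d : Y → Y → ℝ} {δ : ℝ} (h : FourPoint d δ)
    {w : Y} {p : ℕ → Y} {N : ℕ} {t : ℝ} (h0 : ∀ k ≤ N, t ≤ gromovProduct d w (p k) (p k))
    (h1 : ∀ k < N, t ≤ gromovProduct d w (p k) (p (k + 1))) (L : ℕ) :
    ∀ a b, a ≤ b → b ≤ N → b - a ≤ 2 ^ L → t - δ * L ≤ gromovProduct d w (p a) (p b) := by
  induction L with
  | zero =>
    intro a b hab hb hL
    simp only [pow_zero] at hL
    simp only [Nat.cast_zero, mul_zero, sub_zero]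
    rcases Nat.lt_or_ge a b with h' | h'
    · obtain rfl : b = a + 1 := by omega
      exact h1 a (by omega)
    · obtain rfl : b = a := by omega
      exact h0 b hb
  | succ L ih =>
    intro a b hab hb hL
    rw [pow_succ] at hL
    have hc := h w (p a) (p (min (a + 2 ^ L) b)) (p b)
    have h2 := ih a (min (a + 2 ^ L) b) (by omega) (by omega) (by omega)
    have h3 := ih (min (a + 2 ^ L) b) b (by omega) (by omega) (by omega)
    have := le_min h2 h3
    push_cast
    linarith

/-- A rough geodesic lies in a bounded neighbourhood of any discrete quasigeodesic with the same
endpoints. -/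
theorem exists_rough_geodesic_near_quasigeodesic {Y : Type*} {d : Y → Y → ℝ} (hd : IsPseudoDist d)
    {δ : ℝ} (h : FourPoint d δ) (hδ : 0 ≤ δ) {c K lam : ℝ} (hc : 0 ≤ c) (hlam : 0 ≤ lam) :
    ∃ r₀ : ℝ, ∀ (W : ℕ → Y) (m : ℕ) (p : ℕ → Y) (N : ℕ),
      (∀ i j, i ≤ j → j ≤ m → ((j : ℝ) - i) - c ≤ d (W i) (W j) ∧ d (W i) (W j) ≤ ((j : ℝ) - i) + c) →
      (∀ k < N, d (p k) (p (k + 1)) ≤ K) →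
      (∀ k l, k ≤ l → l ≤ N → ((l : ℝ) - k) ≤ lam * d (p k) (p l) + lam) →
      p 0 = W 0 → p N = W m →
      ∀ i ≤ m, ∃ k ≤ N, d (W i) (p k) ≤ r₀ := by
  set B : ℝ := 3 * c + |K| + 2 * δ with hB
  obtain ⟨L₀, hL₀⟩ := exists_bound_of_two_pow_le
    (2 * (lam * (6 * B + 3 + c)) + 1) (2 * (lam * (6 * δ)))
  refine ⟨B + δ * L₀, fun W m p N hW hstep hq hp0 hpN => ?_⟩
  have hmin : ∀ i, ∃ k ≤ N, ∀ k' ≤ N, d (W i) (p k) ≤ d (W i) (p k') := by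
    intro i
    obtain ⟨k, hk, hk'⟩ := Finset.exists_min_image (Finset.range (N + 1)) (fun k => d (W i) (p k))
      ⟨0, by simp⟩
    exact ⟨k, by simpa [Nat.lt_succ_iff] using hk,
      fun k' hk1 => hk' k' (by simpa [Nat.lt_succ_iff] using hk1)⟩
  choose κ hκN hκ using hmin
  -- Work at the point `W i` farthest from the path, at distance `r`. The whole path avoids the ball
  -- of radius `r` around it, and every other point of `W` is within `r` of the path.
  obtain ⟨i, hi, hmax⟩ := Finset.exists_max_image (Finset.range (m + 1))
    (fun i => d (W i) (p (κ i))) ⟨0, by simp⟩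
  have him : i ≤ m := by simpa [Nat.lt_succ_iff] using hi
  set w := W i with hw
  set r := d (W i) (p (κ i)) with hr
  have hr0 : 0 ≤ r := hd.nonneg _ _
  have hfar : ∀ k ≤ N, r ≤ d w (p k) := hκ i
  have hclose : ∀ j ≤ m, d (W j) (p (κ j)) ≤ r := fun j hj =>
    hmax j (by simpa [Nat.lt_succ_iff] using hj)
  suffices hrb : r ≤ B + δ * L₀ from fun j hj => ⟨κ j, hκN j, (hclose j hj).trans hrb⟩
  -- At `2 * r` steps from `w`, hopping from `W` to the path by at most `r` keeps the Gromov product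
  -- based at `w` at least `r - c`. If `W` ends sooner, its endpoint is on the path and no hop is
  -- needed.
  set J := ⌈2 * r⌉₊ with hJ
  have hJ1 : 2 * r ≤ J := Nat.le_ceil _
  have hJ2 : (J : ℝ) ≤ 2 * r + 1 := (Nat.ceil_lt_add_one (by linarith)).le
  -- a point of the path near the lower and the upper point of the rough geodesic
  have hlow : ∃ a ≤ N, d (W (i - J)) (p a) ≤ r ∧
      r - c ≤ gromovProduct d w (W (i - J)) (p a) := by
    rcases Nat.lt_or_ge J i with hlt | hge
    · refine ⟨κ (i - J), hκN _, hclose _ (by omega), ?_⟩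
      have h1 := (hW (i - J) i (by omega) him).1
      have h2 := hfar _ (hκN (i - J))
      have h3 := hclose (i - J) (by omega)
      rw [hd.symm] at h1
      rw [Nat.cast_sub hlt.le] at h1
      simp only [gromovProduct]
      linarith
    · refine ⟨0, by omega, ?_, ?_⟩
      · rw [hp0, show i - J = 0 by omega, hd.self]; exact hr0
      · have h2 := hfar 0 (by omega)
        rw [show i - J = 0 by omega, ← hp0]
        simp only [gromovProduct, hd.self]
        linarith
  have hhigh : ∃ b ≤ N, d (W (min (i + J) m)) (p b) ≤ r ∧
      r - c ≤ gromovProduct d w (p b) (W (min (i + J) m)) := by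
    rcases Nat.lt_or_ge (i + J) m with hlt | hge
    · rw [min_eq_left hlt.le]
      refine ⟨κ (i + J), hκN _, hclose _ (by omega), ?_⟩
      have h1 := (hW i (i + J) (by omega) hlt.le).1
      have h2 := hfar _ (hκN (i + J))
      have h3 := hclose (i + J) (by omega)
      rw [hd.symm] at h3
      push_cast at h1
      simp only [gromovProduct]
      linarith
    · rw [min_eq_right hge]
      refine ⟨N, le_rfl, ?_, ?_⟩
      · rw [hpN, hd.self]; exact hr0
      · have h2 := hfar N le_rfl
        rw [← hpN]
        simp only [gromovProduct, hd.self]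
        linarith
  obtain ⟨a, haN, ha, ha'⟩ := hlow
  obtain ⟨b, hbN, hb, hb'⟩ := hhigh
  have hWW := hW (i - J) (min (i + J) m) (by omega) (by omega)
  have hgap : ((min (i + J) m : ℕ) : ℝ) - ((i - J : ℕ) : ℝ) ≤ 2 * J := by
    have : min (i + J) m ≤ 2 * J + (i - J) := by omega
    have : ((min (i + J) m : ℕ) : ℝ) ≤ 2 * J + ((i - J : ℕ) : ℝ) := by exact_mod_cast this
    linarith
  have hpab : d (p a) (p b) ≤ 6 * r + 2 + c := by
    have h1 := hd.triangle (p a) (W (i - J)) (p b)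
    have h2 := hd.triangle (W (i - J)) (W (min (i + J) m)) (p b)
    rw [hd.symm (p a) (W (i - J))] at h1
    linarith
  have hprod : gromovProduct d w (W (i - J)) (W (min (i + J) m)) ≤ 3 * c / 2 := by
    have h1 := (hW (i - J) i (by omega) him).2
    have h2 := (hW i (min (i + J) m) (by omega) (by omega)).2
    rw [hd.symm] at h1
    simp only [gromovProduct]
    linarith [hWW.1]
  have hself : ∀ k ≤ N, r - |K| ≤ gromovProduct d w (p k) (p k) := by
    intro k hk
    have := hfar k hk
    have := abs_nonneg K
    simp only [gromovProduct, hd.self]; linarith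
  have hnext : ∀ k < N, r - |K| ≤ gromovProduct d w (p k) (p (k + 1)) := by
    intro k hk
    have := hfar k hk.le
    have := hfar (k + 1) hk
    have := hstep k hk
    have := le_abs_self K
    have := abs_nonneg K
    simp only [gromovProduct]; linarith
  obtain ⟨L, hL1, hL2⟩ : ∃ L : ℕ, (2 : ℝ) ^ L ≤ 2 * (lam * (6 * r + 3 + c)) + 1 ∧
      r - |K| - δ * L ≤ gromovProduct d w (p a) (p b) := by
    have main : ∀ a b, a ≤ b → b ≤ N → d (p a) (p b) ≤ 6 * r + 2 + c →
        ∃ L : ℕ, (2 : ℝ) ^ L ≤ 2 * (lam * (6 * r + 3 + c)) + 1 ∧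
          r - |K| - δ * L ≤ gromovProduct d w (p a) (p b) := by
      intro a b hab hbN hpab
      refine ⟨Nat.clog 2 (b - a), ?_, h.chain hself hnext _ a b hab hbN
        (Nat.le_pow_clog one_lt_two _)⟩
      have h1 := two_pow_clog_le (b - a)
      have h2 : (2 : ℝ) ^ Nat.clog 2 (b - a) ≤ 2 * ((b : ℝ) - a) + 1 := by
        rw [← Nat.cast_sub hab]; exact_mod_cast h1
      have h3 := hq a b hab hbN
      nlinarith
    rcases le_total a b with hab | hab
    · exact main a b hab hbN hpab
    · rw [gromovProduct_comm hd]
      exact main b a hab haN (by rwa [hd.symm])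
  have hc1 := h w (W (i - J)) (p b) (W (min (i + J) m))
  have hc2 := h w (W (i - J)) (p a) (p b)
  have hrL : r ≤ B + δ * L := by
    have hK := abs_nonneg K
    have hL : 0 ≤ δ * L := by positivity
    have e1 : r - c - |K| - δ * L ≤ min (gromovProduct d w (W (i - J)) (p a))
        (gromovProduct d w (p a) (p b)) := le_min (by linarith) (by linarith)
    have e2 : r - c - |K| - δ * L - δ ≤ min (gromovProduct d w (W (i - J)) (p b))
        (gromovProduct d w (p b) (W (min (i + J) m))) := le_min (by linarith) (by linarith)
    rw [hB]; linarith
  -- The detour through the path gives `r ≤ B + δ * L`, whereas `2 ^ L` is at most linear in `r`;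
  -- hence `L` is bounded.
  have hLL := hL₀ L (by
    refine hL1.trans ?_
    have : lam * (6 * r + 3 + c) ≤ lam * (6 * (B + δ * L) + 3 + c) := by gcongr
    linarith)
  exact hrL.trans (by gcongr)

/-! ### Word metrics -/

section Word

variable {G : Type*} [Group G] {S : Set G}

theorem wordLength_prod_le {l : List G} (hl : ∀ s ∈ l, s ∈ S ∨ s⁻¹ ∈ S) :
    wordLength S l.prod ≤ l.length :=
  Nat.sInf_le ⟨l, rfl, hl, rfl⟩

/-- Every element is a product of elements of `S` and of their inverses. -/
def WordGenerates (S : Set G) : Prop :=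
  ∀ g : G, ∃ l : List G, (∀ s ∈ l, s ∈ S ∨ s⁻¹ ∈ S) ∧ l.prod = g

theorem WordGenerates.exists_list (hS : WordGenerates S) (g : G) :
    ∃ l : List G, l.length = wordLength S g ∧ (∀ s ∈ l, s ∈ S ∨ s⁻¹ ∈ S) ∧ l.prod = g := by
  obtain ⟨l, hl, hg⟩ := hS g
  exact Nat.sInf_mem (s := {n : ℕ | ∃ l : List G, l.length = n ∧
    (∀ s ∈ l, s ∈ S ∨ s⁻¹ ∈ S) ∧ l.prod = g}) ⟨_, l, rfl, hl, hg⟩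

theorem wordLength_one : wordLength S (1 : G) = 0 :=
  Nat.le_zero.1 (by simpa using wordLength_prod_le (S := S) (l := []) (by simp))

theorem WordGenerates.mul_le (hS : WordGenerates S) (g g' : G) :
    wordLength S (g * g') ≤ wordLength S g + wordLength S g' := by
  obtain ⟨l, hl, hl1, rfl⟩ := hS.exists_list g
  obtain ⟨l', hl', hl1', rfl⟩ := hS.exists_list g'
  rw [← hl, ← hl', ← List.prod_append, ← List.length_append]
  refine wordLength_prod_le fun s hs => ?_
  rcases List.mem_append.1 hs with hs | hs
  exacts [hl1 s hs, hl1' s hs]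

theorem WordGenerates.inv_le (hS : WordGenerates S) (g : G) :
    wordLength S g⁻¹ ≤ wordLength S g := by
  obtain ⟨l, hl, hl1, rfl⟩ := hS.exists_list g
  rw [← hl, List.prod_inv_reverse]
  refine (wordLength_prod_le fun s hs => ?_).trans (by simp)
  simp only [List.mem_reverse, List.mem_map] at hs
  obtain ⟨a, ha, rfl⟩ := hs
  rw [inv_inv]
  exact (hl1 a ha).symm

theorem WordGenerates.isPseudoDist (hS : WordGenerates S) : IsPseudoDist (wordDist S) where
  self x := by simp [wordDist, wordLength_one]
  symm x y := by
    have h1 := hS.inv_le (x⁻¹ * y)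
    have h2 := hS.inv_le (y⁻¹ * x)
    simp only [mul_inv_rev, inv_inv] at h1 h2
    simp only [wordDist]
    exact_mod_cast le_antisymm h2 h1
  triangle x y z := by
    have := hS.mul_le (x⁻¹ * y) (y⁻¹ * z)
    rw [show x⁻¹ * y * (y⁻¹ * z) = x⁻¹ * z by group] at this
    simp only [wordDist]
    exact_mod_cast this

theorem wordDist_mul_left (S : Set G) (a g g' : G) :
    wordDist S (a * g) (a * g') = wordDist S g g' := by
  simp only [wordDist]
  congr 2
  group

theorem wordDist_le_one {s : G} (hs : s ∈ S) (g : G) : wordDist S g (g * s) ≤ 1 := by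
  have := wordLength_prod_le (S := S) (l := [s]) (by simpa using Or.inl hs)
  simp only [List.prod_cons, List.prod_nil, mul_one, List.length_cons, List.length_nil] at this
  simp only [wordDist, inv_mul_cancel_left]
  exact_mod_cast this

end Word

/-! ### The level function of a confining automorphism -/

section Confining

variable {H : Type*} [Group H] {α : MulAut H} {A : Set H}

/-- The projection of `H ⋊ ⟨α⟩` to `ℤ`. -/
def CyclicExtension.height (g : CyclicExtension α) : ℤ := Multiplicative.toAdd g.right

/-- The element of `H ⋊ ⟨α⟩` corresponding to `α ^ n`. -/
def CyclicExtension.power (α : MulAut H) (n : ℤ) : CyclicExtension α :=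
  SemidirectProduct.inr (Multiplicative.ofAdd n)

/-- The inclusion of `H` into `H ⋊ ⟨α⟩`. -/
def CyclicExtension.base (α : MulAut H) (h : H) : CyclicExtension α :=
  SemidirectProduct.inl h

open CyclicExtension

@[simp] theorem CyclicExtension.height_mul (g g' : CyclicExtension α) :
    height (g * g') = height g + height g' := rfl

@[simp] theorem CyclicExtension.height_one : height (1 : CyclicExtension α) = 0 := rfl

@[simp] theorem CyclicExtension.height_power (n : ℤ) : height (power α n) = n := rfl

@[simp] theorem CyclicExtension.height_base (h : H) : height (base α h) = 0 := rfl

@[simp] theorem CyclicExtension.left_mul (g g' : CyclicExtension α) :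
    (g * g').left = g.left * (α ^ height g) g'.left := rfl

@[simp] theorem CyclicExtension.left_power (n : ℤ) : (power α n).left = 1 := rfl

@[simp] theorem CyclicExtension.left_base (h : H) : (base α h).left = h := rfl

@[ext] theorem CyclicExtension.ext_height {g g' : CyclicExtension α} (h : g.left = g'.left)
    (h' : height g = height g') : g = g' :=
  SemidirectProduct.ext h h'

theorem CyclicExtension.power_add (m n : ℤ) : power α (m + n) = power α m * power α n := by
  ext <;> simp

theorem CyclicExtension.power_zero : power α 0 = 1 := rfl

theorem base_mem_confiningGenerators {a : H} (ha : a ∈ A) : base α a ∈ confiningGenerators α A :=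
  Or.inl ⟨a, ha, rfl⟩

theorem power_one_mem_confiningGenerators : power α 1 ∈ confiningGenerators α A :=
  Or.inr (Or.inl rfl)

theorem power_neg_one_mem_confiningGenerators : power α (-1) ∈ confiningGenerators α A :=
  Or.inr (Or.inr rfl)

theorem IsConfining.pow_mem (h : IsConfining α A) {a : H} (ha : a ∈ A) (n : ℕ) :
    (α ^ n) a ∈ A := by
  induction n with
  | zero => simpa
  | succ n ih => rw [pow_succ', MulAut.mul_apply]; exact h.1 ⟨_, ih, rfl⟩

theorem IsConfining.one_mem (h : IsConfining α A) : (1 : H) ∈ A := by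
  obtain ⟨n, hn⟩ := h.2.1 1
  simpa using hn

theorem IsConfining.zpow_mem_of_le (h : IsConfining α A) {a : H} {m n : ℤ} (hmn : m ≤ n)
    (ha : (α ^ m) a ∈ A) : (α ^ n) a ∈ A := by
  obtain ⟨k, rfl⟩ := Int.exists_add_of_le hmn
  rw [add_comm, zpow_add, MulAut.mul_apply, zpow_natCast]
  exact h.pow_mem ha k

/-- Points at height `-k` above `g` and `g'` differ by an element of `A`. -/
def IsLevel (A : Set H) (g g' : CyclicExtension α) (k : ℤ) : Prop :=
  -height g ≤ k ∧ -height g' ≤ k ∧ (α ^ k) (g.left⁻¹ * g'.left) ∈ A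

/-- The height (up to sign) of the confluence of the vertical rays issued from `g` and `g'`. -/
noncomputable def level (A : Set H) (g g' : CyclicExtension α) : ℤ := sInf {k | IsLevel A g g' k}

/-- The integral model of the word metric on `H ⋊ ⟨α⟩`. -/
noncomputable def modelDist (A : Set H) (g g' : CyclicExtension α) : ℝ :=
  height g + height g' + 2 * level A g g'

theorem IsConfining.isLevel_mono (h : IsConfining α A) {g g' : CyclicExtension α} {k k' : ℤ}
    (hk : k ≤ k') (hl : IsLevel A g g' k) : IsLevel A g g' k' :=
  ⟨hl.1.trans hk, hl.2.1.trans hk, h.zpow_mem_of_le hk hl.2.2⟩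

theorem IsConfining.isLevel_level (h : IsConfining α A) (g g' : CyclicExtension α) :
    IsLevel A g g' (level A g g') := by
  obtain ⟨n, hn⟩ := h.2.1 (g.left⁻¹ * g'.left)
  refine Int.csInf_mem (s := {k | IsLevel A g g' k})
    ⟨max n (max (-height g) (-height g')), by simp, by simp, ?_⟩ ⟨-height g, fun k hk => hk.1⟩
  exact h.zpow_mem_of_le (le_max_left _ _) (by simpa using hn)

theorem level_le {g g' : CyclicExtension α} {k : ℤ} (hk : IsLevel A g g' k) :
    level A g g' ≤ k :=
  csInf_le ⟨-height g, fun _ hk => hk.1⟩ hk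

theorem level_comm (hA : ∀ a ∈ A, a⁻¹ ∈ A) (g g' : CyclicExtension α) :
    level A g g' = level A g' g := by
  have : ∀ g g' : CyclicExtension α, ∀ k, IsLevel A g g' k → IsLevel A g' g k := by
    rintro g g' k ⟨h1, h2, h3⟩
    refine ⟨h2, h1, ?_⟩
    have := hA _ h3
    rwa [← map_inv, mul_inv_rev, inv_inv] at this
  simp only [level]
  congr 1
  ext k
  exact ⟨this _ _ k, this _ _ k⟩

/-- If `α ^ k` sends two elements into `A`, then `α ^ (k + n₀)` sends their product into `A`: the
level is ultrametric up to `n₀`. -/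
theorem IsConfining.exists_level_le (h : IsConfining α A) :
    ∃ n₀ : ℕ, ∀ g g' g'' : CyclicExtension α,
      level A g g'' ≤ max (level A g g') (level A g' g'') + n₀ := by
  obtain ⟨n₀, hn₀⟩ := h.2.2
  refine ⟨n₀, fun g g' g'' => level_le ?_⟩
  have h1 := h.isLevel_mono (le_max_left _ (level A g' g'')) (h.isLevel_level g g')
  have h2 := h.isLevel_mono (le_max_right (level A g g') _) (h.isLevel_level g' g'')
  set k := max (level A g g') (level A g' g'')
  refine ⟨h1.1.trans (by simp), h2.2.1.trans (by simp), ?_⟩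
  have := hn₀ _ h1.2.2 _ h2.2.2
  rw [add_comm, zpow_add, MulAut.mul_apply, zpow_natCast]
  rwa [← map_mul, show g.left⁻¹ * g'.left * (g'.left⁻¹ * g''.left) = g.left⁻¹ * g''.left by group]
    at this

/-- Each of the three sums in the four-point inequality contains every height once, so heights
cancel. What remains is the four-point inequality for an ultrametric, with error `2 * n₀`, doubled
by the factor 2 in front of the level. -/
theorem IsConfining.fourPoint_modelDist (h : IsConfining α A) (hA : ∀ a ∈ A, a⁻¹ ∈ A) :
    ∃ δ : ℝ, FourPoint (modelDist A : CyclicExtension α → CyclicExtension α → ℝ) δ := by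
  obtain ⟨n₀, hn₀⟩ := h.exists_level_le
  refine ⟨2 * n₀, fourPoint_of_le_max fun w x y z => ?_⟩
  have h1 := hn₀ x y z
  have h2 := hn₀ x w z
  have h3 := hn₀ w x y
  have h4 := hn₀ w z y
  rw [level_comm hA x w] at h2
  rw [level_comm hA z y] at h4
  have : level A x z + level A w y ≤
      max (level A x y + level A w z) (level A w x + level A y z) + 2 * n₀ := by omega
  have : (level A x z + level A w y : ℝ) ≤
      max (level A x y + level A w z : ℝ) (level A w x + level A y z) + 2 * n₀ := by
    exact_mod_cast this
  simp only [modelDist]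
  rcases max_cases (level A x y + level A w z : ℝ) (level A w x + level A y z) with ⟨e, -⟩ | ⟨e, -⟩
  · refine le_trans ?_ (add_le_add_left (le_max_left _ _) _)
    rw [e] at this
    linarith
  · refine le_trans ?_ (add_le_add_left (le_max_right _ _) _)
    rw [e] at this
    linarith

theorem isLevel_mul_left (γ g g' : CyclicExtension α) (k : ℤ) :
    IsLevel A (γ * g) (γ * g') k ↔ IsLevel A g g' (k + height γ) := by
  have e : (α ^ k) ((γ * g).left⁻¹ * (γ * g').left) =
      (α ^ (k + height γ)) (g.left⁻¹ * g'.left) := by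
    rw [zpow_add, MulAut.mul_apply]
    congr 1
    simp only [left_mul, map_mul, map_inv]
    group
  simp only [IsLevel, height_mul, e]
  exact and_congr (by omega) (and_congr (by omega) Iff.rfl)

theorem IsConfining.modelDist_mul_left (h : IsConfining α A) (γ g g' : CyclicExtension α) :
    modelDist A (γ * g) (γ * g') = modelDist A g g' := by
  have e : level A (γ * g) (γ * g') = level A g g' - height γ := by
    apply le_antisymm
    · apply level_le
      rw [isLevel_mul_left, sub_add_cancel]
      exact h.isLevel_level _ _
    · have := level_le ((isLevel_mul_left γ g g' _).1 (h.isLevel_level _ _))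
      omega
  simp only [modelDist, e, height_mul]
  push_cast
  ring

/-- Going up, across and down. -/
theorem IsLevel.exists_eq {g : CyclicExtension α} {k : ℤ} (hk : IsLevel A 1 g k) :
    ∃ (i j : ℕ) (a : H), a ∈ A ∧ (i : ℤ) = k ∧ (j : ℤ) = k + height g ∧
      g = power α (-i) * base α a * power α j := by
  have h1 := hk.1
  have h2 := hk.2.1
  simp only [height_one] at h1
  obtain ⟨i, hi⟩ := Int.eq_ofNat_of_zero_le (show 0 ≤ k by omega)
  obtain ⟨j, hj⟩ := Int.eq_ofNat_of_zero_le (show 0 ≤ k + height g by omega)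
  refine ⟨i, j, _, hk.2.2, hi.symm, hj.symm, ?_⟩
  ext
  · simp only [left_mul, left_power, height_power, left_base, one_mul, map_one, mul_one, ← hi,
      ← MulAut.mul_apply, ← zpow_add, neg_add_cancel, zpow_zero, MulAut.one_apply]
    simp
  · simp only [height_mul, height_power, height_base]
    omega

/-- The path going up, across and down. -/
noncomputable def verticalPath (α : MulAut H) (a : H) (i p : ℕ) : CyclicExtension α :=
  if p ≤ i then power α (-p) else power α (-i) * base α a * power α ((p : ℤ) - i - 1)

/-- The step from index `i` to `i + 1` is the horizontal letter `a`; this accounts for the `- 1` in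
the exponent of the descending half. -/
theorem exists_mem_verticalPath_succ {a : H} (ha : a ∈ A) (i p : ℕ) :
    ∃ s ∈ confiningGenerators α A, verticalPath α a i (p + 1) = verticalPath α a i p * s := by
  rcases lt_trichotomy p i with hp | rfl | hp
  · refine ⟨_, power_neg_one_mem_confiningGenerators, ?_⟩
    rw [verticalPath, verticalPath, if_pos (by omega), if_pos (by omega), ← power_add]
    push_cast
    congr 1
    ring
  · refine ⟨_, base_mem_confiningGenerators ha, ?_⟩
    rw [verticalPath, verticalPath, if_neg (by omega), if_pos le_rfl]
    push_cast
    rw [show (p : ℤ) + 1 - p - 1 = 0 by ring, power_zero, mul_one]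
  · refine ⟨_, power_one_mem_confiningGenerators, ?_⟩
    rw [verticalPath, verticalPath, if_neg (by omega), if_neg (by omega), mul_assoc, mul_assoc,
      mul_assoc, ← power_add]
    push_cast
    congr 3
    ring

theorem wordGenerates_of_path {G : Type*} [Group G] {S : Set G} {p : ℕ → G} (h0 : p 0 = 1)
    (h : ∀ k, ∃ s ∈ S, p (k + 1) = p k * s) (n : ℕ) :
    ∃ l : List G, (∀ s ∈ l, s ∈ S ∨ s⁻¹ ∈ S) ∧ l.prod = p n := by
  induction n with
  | zero => exact ⟨[], by simp, by simp [h0]⟩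
  | succ n ih =>
    obtain ⟨l, hl, hp⟩ := ih
    obtain ⟨s, hs, e⟩ := h n
    refine ⟨l ++ [s], fun x hx => ?_, by simp [hp, e]⟩
    rcases List.mem_append.1 hx with hx | hx
    · exact hl x hx
    · rw [List.mem_singleton.1 hx]; exact Or.inl hs

theorem verticalPath_zero (a : H) (i : ℕ) : verticalPath α a i 0 = 1 := by
  simp [verticalPath, power_zero]

theorem verticalPath_top (a : H) (i : ℕ) : verticalPath α a i i = power α (-i) := by
  simp [verticalPath]

theorem verticalPath_end (a : H) (i j : ℕ) :
    verticalPath α a i (i + j + 1) = power α (-i) * base α a * power α j := by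
  rw [verticalPath, if_neg (by omega)]
  push_cast
  congr 2
  ring

theorem IsConfining.wordGenerates (h : IsConfining α A) :
    WordGenerates (confiningGenerators α A) := by
  intro g
  obtain ⟨i, j, a, ha, -, -, rfl⟩ := (h.isLevel_level 1 g).exists_eq
  rw [← verticalPath_end]
  exact wordGenerates_of_path (verticalPath_zero a i) (exists_mem_verticalPath_succ ha i) _

/-! ### Comparison of the word metric with the model distance -/

theorem wordDist_le_of_path {G : Type*} [Group G] {S : Set G} (hS : WordGenerates S) {p : ℕ → G}
    (h : ∀ k, ∃ s ∈ S, p (k + 1) = p k * s) {i j : ℕ} (hij : i ≤ j) :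
    wordDist S (p i) (p j) ≤ (j : ℝ) - i := by
  induction j, hij using Nat.le_induction with
  | base => rw [hS.isPseudoDist.self]; simp
  | succ j hij ih =>
    obtain ⟨s, hs, e⟩ := h j
    have h1 := hS.isPseudoDist.triangle (p i) (p j) (p (j + 1))
    have h2 := wordDist_le_one hs (p j)
    rw [← e] at h2
    push_cast
    linarith

theorem IsConfining.wordDist_le (h : IsConfining α A) (g g' : CyclicExtension α) :
    wordDist (confiningGenerators α A) g g' ≤ modelDist A g g' + 1 := by
  rw [← wordDist_mul_left _ g⁻¹ g g', ← h.modelDist_mul_left g⁻¹ g g', inv_mul_cancel]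
  generalize g⁻¹ * g' = g
  obtain ⟨i, j, a, ha, hi, hj, e⟩ := (h.isLevel_level 1 g).exists_eq
  have h1 := wordDist_le_of_path h.wordGenerates (exists_mem_verticalPath_succ ha i)
    (Nat.zero_le (i + j + 1))
  rw [verticalPath_zero, verticalPath_end, ← e] at h1
  have h2 : (i : ℝ) + j = 2 * level A 1 g + height g := by
    exact_mod_cast (by omega : (i : ℤ) + j = 2 * level A 1 g + height g)
  simp only [modelDist, height_one]
  push_cast at h1 ⊢
  linarith

/-- Here `-K` is the lowest height met when the word is read from `g`. A letter of `A` read at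
height `t` is pushed by `α ^ (K + t)`, with `K + t ≥ 0`, hence stays in `A`. The vertical letters
number at least the cost of going from `g` to height `-K` and back to the endpoint, and the
`m.length` horizontal letters come on top of that. -/
theorem exists_level_of_word {l : List (CyclicExtension α)}
    (hl : ∀ s ∈ l, s ∈ confiningGenerators α A) (h : IsConfining α A) (g : CyclicExtension α) :
    ∃ (K : ℤ) (m : List H), (∀ a ∈ m, a ∈ A) ∧ m.prod = (α ^ K) (g.left⁻¹ * (g * l.prod).left) ∧
      -height g ≤ K ∧ -height (g * l.prod) ≤ K ∧
      2 * K + height g + height (g * l.prod) + m.length ≤ l.length := by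
  induction l generalizing g with
  | nil =>
    refine ⟨-height g, [], by simp, by simp, by simp, by simp, ?_⟩
    simp only [List.prod_nil, mul_one, List.length_nil]
    push_cast; linarith
  | cons s l ih =>
    obtain ⟨K, m, hm, hp, h1, h2, h3⟩ := ih (fun x hx => hl x (List.mem_cons_of_mem _ hx)) (g * s)
    rw [mul_assoc, ← List.prod_cons] at hp h2 h3
    rcases hl s List.mem_cons_self with ⟨a, ha, rfl⟩ | rfl | rfl
    · change -height (g * base α a) ≤ K at h1
      change m.prod = (α ^ K) ((g * base α a).left⁻¹ * _) at hp
      change 2 * K + height (g * base α a) + _ + _ ≤ _ at h3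
      rw [height_mul, height_base, add_zero] at h1 h3
      refine ⟨K, (α ^ (K + height g)) a :: m, ?_, ?_, h1, h2, ?_⟩
      · rintro x hx
        rcases List.mem_cons.1 hx with rfl | hx
        · exact h.zpow_mem_of_le (m := 0) (by omega) (by simpa using ha)
        · exact hm x hx
      · rw [List.prod_cons, hp, zpow_add, MulAut.mul_apply, ← map_mul]
        congr 1
        rw [left_mul g (base α a), left_base]
        group
      · rw [List.length_cons, List.length_cons]
        push_cast
        linarith
    · change -height (g * power α 1) ≤ K at h1
      change m.prod = (α ^ K) ((g * power α 1).left⁻¹ * _) at hp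
      change 2 * K + height (g * power α 1) + _ + _ ≤ _ at h3
      rw [left_mul, left_power, map_one, mul_one] at hp
      rw [height_mul, height_power] at h1 h3
      rcases le_or_gt (-height g) K with hK | hK
      · refine ⟨K, m, hm, hp, hK, h2, ?_⟩
        rw [List.length_cons]
        push_cast
        linarith
      · refine ⟨K + 1, m.map (α : H → H), ?_, ?_, by omega, by omega, ?_⟩
        · intro x hx
          obtain ⟨a, ha, rfl⟩ := List.mem_map.1 hx
          exact h.1 ⟨a, hm a ha, rfl⟩
        · have : (m.map (α : H → H)).prod = α m.prod := (map_list_prod α m).symm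
          rw [this, hp, add_comm, zpow_add, zpow_one, MulAut.mul_apply]
        · rw [List.length_cons, List.length_map]
          push_cast
          omega
    · change -height (g * power α (-1)) ≤ K at h1
      change m.prod = (α ^ K) ((g * power α (-1)).left⁻¹ * _) at hp
      change 2 * K + height (g * power α (-1)) + _ + _ ≤ _ at h3
      rw [left_mul, left_power, map_one, mul_one] at hp
      rw [height_mul, height_power] at h1 h3
      refine ⟨K, m, hm, hp, by omega, h2, ?_⟩
      rw [List.length_cons]
      push_cast
      omega

/-- Split the product in two halves; each halving costs one factor `α ^ n₀`. -/
theorem IsConfining.pow_prod_mem (h : IsConfining α A) {n₀ : ℕ}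
    (hn₀ : ∀ a ∈ A, ∀ b ∈ A, (α ^ n₀) (a * b) ∈ A) (L : ℕ) :
    ∀ m : List H, (∀ a ∈ m, a ∈ A) → m.length ≤ 2 ^ L → (α ^ (n₀ * L)) m.prod ∈ A := by
  induction L with
  | zero =>
    intro m hm hL
    rcases m with _ | ⟨a, _ | ⟨b, m⟩⟩
    · simpa using h.one_mem
    · simpa using hm a (by simp)
    · simp at hL
  | succ L ih =>
    intro m hm hL
    rw [pow_succ] at hL
    have h1 := ih (m.take (2 ^ L)) (fun a ha => hm a (List.mem_of_mem_take ha)) (by simp)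
    have h2 := ih (m.drop (2 ^ L)) (fun a ha => hm a (List.mem_of_mem_drop ha))
      (by rw [List.length_drop]; omega)
    have := hn₀ _ h1 _ h2
    rwa [← map_mul, ← List.prod_append, List.take_append_drop, ← MulAut.mul_apply, ← pow_add,
      show n₀ + n₀ * L = n₀ * (L + 1) by ring] at this

theorem mem_confiningGenerators_of_inv (hA : ∀ a ∈ A, a⁻¹ ∈ A) {s : CyclicExtension α}
    (hs : s ∈ confiningGenerators α A ∨ s⁻¹ ∈ confiningGenerators α A) :
    s ∈ confiningGenerators α A := by
  rcases hs with hs | ⟨a, ha, e⟩ | e | e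
  · exact hs
  · rw [← inv_inv s, ← e, ← map_inv]
    exact base_mem_confiningGenerators (hA a ha)
  · rw [← inv_inv s, e, ← map_inv]
    exact power_neg_one_mem_confiningGenerators
  · rw [← inv_inv s, Set.mem_singleton_iff.1 e, ← map_inv]
    exact power_one_mem_confiningGenerators

theorem IsConfining.exists_modelDist_le (h : IsConfining α A) (hA : ∀ a ∈ A, a⁻¹ ∈ A) :
    ∃ C : ℝ, ∀ g g' : CyclicExtension α,
      modelDist A g g' ≤ wordDist (confiningGenerators α A) g g' + C := by
  obtain ⟨n₀, hn₀⟩ := h.2.2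
  refine ⟨8 * n₀ ^ 2 + 1, fun g g' => ?_⟩
  obtain ⟨l, hl, hlS, hlp⟩ := h.wordGenerates.exists_list (g⁻¹ * g')
  obtain ⟨K, m, hm, hp, h1, h2, h3⟩ := exists_level_of_word
    (fun s hs => mem_confiningGenerators_of_inv hA (hlS s hs)) h g
  rw [hlp, mul_inv_cancel_left] at hp h2 h3
  set L := Nat.clog 2 m.length
  have hmem := h.pow_prod_mem hn₀ L m hm (Nat.le_pow_clog one_lt_two _)
  rw [hp, ← zpow_natCast, ← MulAut.mul_apply, ← zpow_add] at hmem
  have hlev := level_le (k := ((n₀ * L : ℕ) : ℤ) + K) ⟨by omega, by omega, hmem⟩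
  have hL : (2 : ℝ) ^ L ≤ 2 * m.length + 1 := by
    have := two_pow_clog_le m.length
    exact_mod_cast this
  have hlev' : (level A g g' : ℝ) ≤ n₀ * L + K := by exact_mod_cast hlev
  have h3' : 2 * (K : ℝ) + height g + height g' + m.length ≤ l.length := by exact_mod_cast h3
  have hsq := sq_le_four_mul_two_pow L
  simp only [modelDist, wordDist, ← hl]
  -- The excess is at most `2 * n₀ * L - m.length`, where `m.length` is at least `(L + 1) ^ 2 / 8 -
  -- 1 / 2`. The maximum of this quadratic is near `L + 1 = 8 * n₀`, whence the constant `8 * n₀ ^ 2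
  -- + 1`.
  nlinarith [sq_nonneg ((L : ℝ) + 1 - 8 * n₀)]

/-- The four-point inequality survives additive errors, in general not multiplicative ones; this is
why comparisons with the model are needed up to additive constants. -/
theorem FourPoint.of_abs_sub_le {Y Z : Type*} {d : Y → Y → ℝ} {d' : Z → Z → ℝ} {δ C : ℝ}
    (f : Z → Y) (h : FourPoint d δ) (hC : ∀ y y', |d (f y) (f y') - d' y y'| ≤ C) :
    FourPoint d' (δ + 2 * C) := by
  refine fourPoint_of_le_max fun w x y z => ?_
  have h1 := abs_le.1 (hC x z)
  have h2 := abs_le.1 (hC w y)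
  have h3 := abs_le.1 (hC x y)
  have h4 := abs_le.1 (hC w z)
  have h5 := abs_le.1 (hC w x)
  have h6 := abs_le.1 (hC y z)
  have := h.le_max (f w) (f x) (f y) (f z)
  have e1 := le_max_left (d' x y + d' w z) (d' w x + d' y z)
  have e2 := le_max_right (d' x y + d' w z) (d' w x + d' y z)
  rcases max_cases (d (f x) (f y) + d (f w) (f z)) (d (f w) (f x) + d (f y) (f z))
    with ⟨e, -⟩ | ⟨e, -⟩ <;> rw [e] at this <;> linarith

theorem IsConfining.fourPoint_wordDist (h : IsConfining α A) (hA : ∀ a ∈ A, a⁻¹ ∈ A) :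
    ∃ δ : ℝ, FourPoint (wordDist (confiningGenerators α A)) δ := by
  obtain ⟨δ, hδ⟩ := h.fourPoint_modelDist hA
  obtain ⟨C, hC⟩ := h.exists_modelDist_le hA
  refine ⟨_, hδ.of_abs_sub_le id (C := max C 1) fun g g' => abs_le.2 ⟨?_, ?_⟩⟩
  · have := h.wordDist_le g g'
    have := le_max_right C 1
    simp only [id]
    linarith
  · have := hC g g'
    have := le_max_left C 1
    simp only [id]
    linarith

end Confining

/-! ### The boundary of a hyperbolic space -/

section Boundary

variable {X : Type*} [MetricSpace X]

theorem gromovProduct_dist_comm (w x y : X) :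
    gromovProduct dist w x y = gromovProduct dist w y x :=
  gromovProduct_comm isPseudoDist_dist w x y

theorem abs_gromovProduct_sub_le (w w' y z : X) :
    |gromovProduct dist w y z - gromovProduct dist w' y z| ≤ dist w w' := by
  have h1 := dist_triangle w w' y
  have h2 := dist_triangle w' w y
  have h3 := dist_triangle w w' z
  have h4 := dist_triangle w' w z
  rw [dist_comm w' w] at h2 h4
  simp only [gromovProduct]
  rw [abs_le]
  constructor <;> linarith

theorem isCauchyGromov_of_forall {u : ℕ → X} (w : X)
    (h : ∀ T : ℝ, ∃ N : ℕ, ∀ n ≥ N, ∀ m ≥ N, T ≤ gromovProduct dist w (u n) (u m)) :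
    IsCauchyGromov u := by
  intro w'
  rw [tendsto_atTop]
  intro T
  obtain ⟨N, hN⟩ := h (T + dist w' w)
  filter_upwards [eventually_ge_atTop (N, N)] with p hp
  have h1 := hN p.1 hp.1 p.2 hp.2
  have h2 := abs_le.1 (abs_gromovProduct_sub_le w' w (u p.1) (u p.2))
  linarith

theorem IsCauchyGromov.exists_forall {u : ℕ → X} (hu : IsCauchyGromov u) (w : X) (T : ℝ) :
    ∃ N : ℕ, ∀ n ≥ N, ∀ m ≥ N, T ≤ gromovProduct dist w (u n) (u m) := by
  obtain ⟨⟨a, b⟩, hab⟩ := eventually_atTop.1 (tendsto_atTop.1 (hu w) T)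
  exact ⟨max a b, fun n hn m hm =>
    hab (n, m) ⟨(le_max_left _ _).trans hn, (le_max_right _ _).trans hm⟩⟩

variable {δ : ℝ}

theorem CauchyGromovRel.exists_forall (hX : FourPoint (dist : X → X → ℝ) δ)
    {u v : {u : ℕ → X // IsCauchyGromov u}} (h : CauchyGromovRel X u v) (w : X) (T : ℝ) :
    ∃ N : ℕ, ∀ n ≥ N, ∀ m ≥ N, T ≤ gromovProduct dist w (u.1 n) (v.1 m) := by
  obtain ⟨N₁, h1⟩ := u.2.exists_forall w (T + δ)
  obtain ⟨N₂, h2⟩ := eventually_atTop.1 (tendsto_atTop.1 (h w) (T + δ))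
  refine ⟨max N₁ N₂, fun n hn m hm => ?_⟩
  have h3 := h1 n ((le_max_left _ _).trans hn) m ((le_max_left _ _).trans hm)
  have h4 := h2 m ((le_max_right _ _).trans hm)
  have h5 := hX w (u.1 n) (u.1 m) (v.1 m)
  have h6 := le_min h3 h4
  linarith

/-- One pair of far terms with large product is enough: the Cauchy property of each sequence links
it to all later terms, at the cost of two four-point inequalities. -/
theorem cauchyGromovRel_of_frequently (hX : FourPoint (dist : X → X → ℝ) δ)
    {u v : {u : ℕ → X // IsCauchyGromov u}} (w : X)
    (h : ∀ (T : ℝ) (N : ℕ), ∃ n ≥ N, ∃ m ≥ N, T ≤ gromovProduct dist w (u.1 n) (v.1 m)) :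
    CauchyGromovRel X u v := by
  intro w'
  rw [tendsto_atTop]
  intro T
  set T' := T + dist w' w + 2 * δ + |δ| with hT'
  obtain ⟨N₁, h1⟩ := u.2.exists_forall w T'
  obtain ⟨N₂, h2⟩ := v.2.exists_forall w T'
  obtain ⟨n, hn, m, hm, hnm⟩ := h T' (max N₁ N₂)
  filter_upwards [eventually_ge_atTop (max N₁ N₂)] with k hk
  have h3 := h1 k ((le_max_left _ _).trans hk) n ((le_max_left _ _).trans hn)
  have h4 := h2 m ((le_max_right _ _).trans hm) k ((le_max_right _ _).trans hk)
  have h5 := hX w (u.1 k) (u.1 n) (v.1 m)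
  have h6 := hX w (u.1 k) (v.1 m) (v.1 k)
  have h7 : T' - |δ| - δ ≤ gromovProduct dist w (u.1 k) (v.1 m) := by
    have := le_min h3 hnm
    have := abs_nonneg δ
    linarith
  have h8 : T' - |δ| - δ ≤ gromovProduct dist w (v.1 m) (v.1 k) := by
    have := neg_abs_le δ
    linarith
  have h9 := le_min h7 h8
  have h10 := abs_le.1 (abs_gromovProduct_sub_le w' w (u.1 k) (v.1 k))
  linarith

theorem cauchyGromovRel_equivalence (hX : FourPoint (dist : X → X → ℝ) δ) :
    Equivalence (CauchyGromovRel X) where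
  refl u w := by
    rw [tendsto_atTop]
    intro T
    obtain ⟨N, hN⟩ := u.2.exists_forall w T
    filter_upwards [eventually_ge_atTop N] with n hn using hN n hn n hn
  symm h w := by
    simpa only [gromovProduct_dist_comm] using h w
  trans {u v z} h h' w := by
    rw [tendsto_atTop]
    intro T
    filter_upwards [tendsto_atTop.1 (h w) (T + δ), tendsto_atTop.1 (h' w) (T + δ)] with n h1 h2
    have := hX w (u.1 n) (v.1 n) (z.1 n)
    have := le_min h1 h2
    linarith

theorem visualBoundary_mk_eq_iff (hX : FourPoint (dist : X → X → ℝ) δ)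
    {u v : {u : ℕ → X // IsCauchyGromov u}} :
    Quot.mk (CauchyGromovRel X) u = Quot.mk (CauchyGromovRel X) v ↔ CauchyGromovRel X u v := by
  rw [Quot.eq, (cauchyGromovRel_equivalence hX).eqvGen_iff]

/-! ### Horokernels -/

/-- Among the three sums of opposite distances of `x, y, u, v`, the sum `dist x y + dist u v` is too
small to matter when `u` and `v` are close seen from `x`; the other two then agree up to `2 * δ`. -/
theorem abs_busemann_sub_le (hX : FourPoint (dist : X → X → ℝ) δ) {x y u v : X}
    (h : dist x y + δ < gromovProduct dist x u v) :
    |(dist x u - dist y u) - (dist x v - dist y v)| ≤ 2 * δ := by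
  have h1 := hX.le_max y x v u
  have h2 := hX.le_max y x u v
  have h3 := dist_triangle x y v
  have h4 := dist_triangle x y u
  simp only [gromovProduct] at h
  rw [dist_comm v u, dist_comm y x] at h1
  rw [dist_comm y x] at h2
  rw [abs_le]
  rcases max_cases (dist x v + dist y u) (dist x y + dist u v) with ⟨e, -⟩ | ⟨e, -⟩ <;>
    rcases max_cases (dist x u + dist y v) (dist x y + dist u v) with ⟨e', -⟩ | ⟨e', -⟩ <;>
    rw [e] at h1 <;> rw [e'] at h2 <;> constructor <;> linarith

theorem eventually_abs_sub_horokernel_le (hX : FourPoint (dist : X → X → ℝ) δ)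
    {ξ : VisualBoundary X} {h : X × X → ℝ} (hh : h ∈ horokernels ξ)
    {u : {u : ℕ → X // IsCauchyGromov u}} (hu : Quot.mk (CauchyGromovRel X) u = ξ) (x y : X) :
    ∀ᶠ n in atTop, |(dist x (u.1 n) - dist y (u.1 n)) - h (x, y)| ≤ 2 * δ := by
  obtain ⟨v, hv, hcl⟩ := hh
  have hrel : CauchyGromovRel X u v := (visualBoundary_mk_eq_iff hX).1 (hu.trans hv.symm)
  obtain ⟨N, hN⟩ := hrel.exists_forall hX x (dist x y + δ + 1)
  filter_upwards [eventually_ge_atTop N] with n hn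
  refine le_of_forall_pos_le_add fun ε hε => ?_
  have hc : MapClusterPt (h (x, y)) atTop (fun n => dist x (v.1 n) - dist y (v.1 n)) :=
    MapClusterPt.continuousAt_comp (f := fun F : X × X → ℝ => F (x, y))
      (continuous_apply _).continuousAt hcl
  obtain ⟨m, hm, hm'⟩ := ((hc.frequently (Metric.ball_mem_nhds _ hε)).and_eventually
    (eventually_ge_atTop N)).exists
  have h1 := abs_busemann_sub_le hX (x := x) (y := y) (u := u.1 n) (v := v.1 m)
    (by linarith [hN n hn m hm'])
  rw [Real.dist_eq] at hm
  have := abs_sub_le (dist x (u.1 n) - dist y (u.1 n)) (dist x (v.1 m) - dist y (v.1 m)) (h (x, y))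
  linarith

theorem horokernels_nonempty (ξ : VisualBoundary X) : (horokernels ξ).Nonempty := by
  obtain ⟨u, rfl⟩ := Quot.exists_rep ξ
  have hK : IsCompact (Set.pi Set.univ fun p : X × X => Set.Icc (-dist p.1 p.2) (dist p.1 p.2)) :=
    isCompact_univ_pi fun _ => isCompact_Icc
  obtain ⟨h, -, hh⟩ := hK.exists_mapClusterPt_of_frequently (l := atTop)
    (f := fun (n : ℕ) (p : X × X) => dist p.1 (u.1 n) - dist p.2 (u.1 n)) (by
      refine (Eventually.of_forall fun n p _ => ?_).frequently
      exact abs_le.1 (abs_dist_sub_le _ _ _))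
  exact ⟨h, u, rfl, hh⟩

/-- Closed conditions pass to pointwise accumulation points, so the cocycle and Lipschitz properties
hold without error. -/
theorem horokernel_mem_of_isClosed {ξ : VisualBoundary X} {h : X × X → ℝ} (hh : h ∈ horokernels ξ)
    {s : Set (X × X → ℝ)} (hs : IsClosed s)
    (hmem : ∀ z : X, (fun p : X × X => dist p.1 z - dist p.2 z) ∈ s) : h ∈ s := by
  obtain ⟨u, -, hcl⟩ := hh
  by_contra hc
  obtain ⟨n, hn⟩ := (hcl.frequently (hs.isOpen_compl.mem_nhds hc)).exists
  exact hn (hmem _)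

/-- Quasi-invariant horofunctions, with the hyperbolicity inequality at the point at infinity. -/
structure IsQuasiHorofunction (Γ : Type*) [Group Γ] {X : Type*} [MetricSpace X] [MulAction Γ X]
    (h : X → X → ℝ) (C : ℝ) : Prop where
  nonneg : 0 ≤ C
  cocycle : ∀ x y z, h x y + h y z = h x z
  abs_le_dist : ∀ x y, |h x y| ≤ dist x y
  quasi_invariant : ∀ (g : Γ) (x y : X), |h (g • x) (g • y) - h x y| ≤ C
  dist_le : ∀ x y z, dist x y ≤ max (dist x z + h y z) (dist y z + h x z) + C

section Action

variable {Γ : Type*} [Group Γ] [MulAction Γ X]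

/-- Any sequence representing `ξ` computes `h` within `2 * δ`. Quasi-invariance compares `u` with `g
• u`, which also represents `ξ`; `dist_le` is the four-point inequality with fourth point `u n`. -/
theorem isQuasiHorofunction_of_mem_horokernels [IsIsometricSMul Γ X] [Nonempty X]
    (hX : FourPoint (dist : X → X → ℝ) δ) {ξ : VisualBoundary X} (hξ : ∀ g : Γ, g • ξ = ξ)
    {h : X × X → ℝ} (hh : h ∈ horokernels ξ) :
    IsQuasiHorofunction Γ (fun x y => h (x, y)) (4 * δ) where
  nonneg := by linarith [hX.nonneg]
  cocycle x y z := horokernel_mem_of_isClosed hh (s := {F | F (x, y) + F (y, z) = F (x, z)})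
    (isClosed_eq (by fun_prop) (by fun_prop)) (fun a => by simp)
  abs_le_dist x y := horokernel_mem_of_isClosed hh (s := {F | |F (x, y)| ≤ dist x y})
    (isClosed_le (by fun_prop) (by fun_prop)) (fun a => abs_dist_sub_le _ _ _)
  quasi_invariant g x y := by
    obtain ⟨u, hu⟩ := Quot.exists_rep ξ
    have hgu : Quot.mk (CauchyGromovRel X) ⟨fun n => g • u.1 n, u.2.smul g⟩ = ξ := by
      rw [← hξ g, ← hu]; rfl
    obtain ⟨n, h1, h2⟩ := ((eventually_abs_sub_horokernel_le hX hh hu x y).and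
      (eventually_abs_sub_horokernel_le hX hh hgu (g • x) (g • y))).exists
    simp only [dist_smul] at h2
    rw [abs_le] at *
    constructor <;> linarith
  dist_le x y z := by
    obtain ⟨u, hu⟩ := Quot.exists_rep ξ
    obtain ⟨n, h1, h2⟩ := ((eventually_abs_sub_horokernel_le hX hh hu x z).and
      (eventually_abs_sub_horokernel_le hX hh hu y z)).exists
    have h3 := hX.le_max z x (u.1 n) y
    rw [dist_comm z y, dist_comm z x, dist_comm (u.1 n) y] at h3
    rw [abs_le] at h1 h2
    have e1 := le_max_left (dist x z + h (y, z)) (dist y z + h (x, z))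
    have e2 := le_max_right (dist x z + h (y, z)) (dist y z + h (x, z))
    rcases max_cases (dist x (u.1 n) + dist y z) (dist x z + dist y (u.1 n)) with ⟨e, -⟩ | ⟨e, -⟩ <;>
      rw [e] at h3 <;> linarith

namespace IsQuasiHorofunction

variable {h : X → X → ℝ} {C : ℝ}

theorem self (H : IsQuasiHorofunction Γ h C) (x : X) : h x x = 0 := by linarith [H.cocycle x x x]

theorem swap (H : IsQuasiHorofunction Γ h C) (x y : X) : h y x = -h x y := by linarith [H.cocycle x y x, H.self x]

theorem abs_mul_sub_le (H : IsQuasiHorofunction Γ h C) (g g' : Γ) (x : X) :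
    |h x ((g * g') • x) - h x (g • x) - h x (g' • x)| ≤ C := by
  have h1 := H.cocycle x (g • x) ((g * g') • x)
  have h2 := H.quasi_invariant g x (g' • x)
  rw [← mul_smul] at h2
  rwa [← h1, add_sub_cancel_left]

theorem exists_slope (H : IsQuasiHorofunction Γ h C) (g : Γ) (x : X) :
    ∃ l : ℝ, ∀ n : ℕ, |h x (g ^ n • x) - n * l| ≤ C :=
  exists_slope_of_quasiAdditive fun m n => by
    rw [pow_add]; exact H.abs_mul_sub_le _ _ x

theorem abs_sub_le_of_tendsto (H : IsQuasiHorofunction Γ h C) {g : Γ} {x : X} {b : ℝ}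
    (hb : Tendsto (fun n : ℕ => h x (g ^ n • x) / (n : ℝ)) atTop (𝓝 b)) (n : ℕ) :
    |h x (g ^ n • x) - n * b| ≤ C := by
  obtain ⟨l, hl⟩ := H.exists_slope g x
  rw [tendsto_nhds_unique hb (tendsto_div_of_abs_sub_le hl)]
  exact hl n

theorem abs_base_change_le (H : IsQuasiHorofunction Γ h C) (g : Γ) (x y : X) :
    |h y (g • y) - h x (g • x)| ≤ C + 2 * dist x y := by
  have h1 := H.cocycle y x (g • x)
  have h2 := H.cocycle y (g • x) (g • y)
  have h3 := abs_le.1 (H.quasi_invariant g x y)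
  have h4 := abs_le.1 (H.abs_le_dist x y)
  have h5 := H.swap x y
  have := H.nonneg
  rw [abs_le]
  constructor <;> linarith

/-- A hyperbolic isometry has nonzero translation number along the horofunction. -/
theorem ne_zero_of_isHyperbolicIsometry [IsIsometricSMul Γ X]
    (H : IsQuasiHorofunction Γ h C) {g : Γ} (hg : IsHyperbolicIsometry X g) (x : X) {b : ℝ} (hb : ∀ n : ℕ, |h x (g ^ n • x) - n * b| ≤ C) :
    b ≠ 0 := by
  rintro rfl
  obtain ⟨l, hl, hlim⟩ := hg
  have hlim := hlim x
  have h2 : Tendsto (fun n : ℕ => dist x (g ^ (2 * n) • x) / ((2 * n : ℕ) : ℝ)) atTop (𝓝 l) :=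
    hlim.comp (tendsto_id.const_mul_atTop' two_pos)
  have h0 : Tendsto (fun n : ℕ => 3 * C / (n : ℝ)) atTop (𝓝 0) :=
    tendsto_const_nhds.div_atTop tendsto_natCast_atTop_atTop
  have h3 := (hlim.add h0)
  -- If `b = 0`, the points `x`, `g ^ n • x`, `g ^ (2 * n) • x` are on one horosphere up to a
  -- constant. Then `dist_le` makes going `2 * n` steps no longer than going `n` steps, up to `3 *
  -- C`, which contradicts linear growth.
  have h4 : 2 * l ≤ l + 0 := by
    refine le_of_tendsto_of_tendsto (h2.const_mul 2) h3 ?_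
    filter_upwards [eventually_gt_atTop 0] with n hn
    have hn' : (0 : ℝ) < n := by exact_mod_cast hn
    have e1 := H.dist_le x (g ^ (2 * n) • x) (g ^ n • x)
    have e2 : dist (g ^ (2 * n) • x) (g ^ n • x) = dist x (g ^ n • x) := by
      rw [two_mul, pow_add, mul_smul, dist_smul, dist_comm]
    have e3 := H.cocycle x (g ^ n • x) (g ^ (2 * n) • x)
    have e4 := H.swap (g ^ n • x) (g ^ (2 * n) • x)
    have e5 := abs_le.1 (hb n)
    have e6 := abs_le.1 (hb (2 * n))
    rw [mul_zero, sub_zero] at e5 e6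
    rw [e2] at e1
    have e7 : dist x (g ^ (2 * n) • x) ≤ dist x (g ^ n • x) + 3 * C := by
      have := H.nonneg
      rcases max_cases (dist x (g ^ n • x) + h (g ^ (2 * n) • x) (g ^ n • x))
        (dist x (g ^ n • x) + h x (g ^ n • x)) with ⟨e, -⟩ | ⟨e, -⟩ <;> rw [e] at e1 <;> linarith
    push_cast
    field_simp
    linarith
  linarith

end IsQuasiHorofunction

/-! ### The Busemann quasicharacter: existence, uniqueness, additivity -/

theorem exists_isBusemannQuasicharacter [IsIsometricSMul Γ X] [Nonempty X]
    (hX : FourPoint (dist : X → X → ℝ) δ) {ξ : VisualBoundary X} (hξ : ∀ g : Γ, g • ξ = ξ) :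
    ∃ β : Γ → ℝ, IsBusemannQuasicharacter ξ β := by
  obtain ⟨h₀, hh₀⟩ := horokernels_nonempty ξ
  obtain ⟨x₀⟩ := ‹Nonempty X›
  have H₀ := isQuasiHorofunction_of_mem_horokernels hX hξ hh₀
  choose β hβ using fun g => H₀.exists_slope g x₀
  refine ⟨β, fun h hh x g => ?_⟩
  -- Three errors of `4 * δ`: change of horokernel, change of base point, and slope.
  refine tendsto_div_of_abs_sub_le (C := 12 * δ + 2 * dist x₀ x) fun n => ?_
  obtain ⟨u, hu⟩ := Quot.exists_rep ξ
  obtain ⟨m, h1, h2⟩ := ((eventually_abs_sub_horokernel_le hX hh hu x (g ^ n • x)).and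
    (eventually_abs_sub_horokernel_le hX hh₀ hu x (g ^ n • x))).exists
  have h3 := abs_le.1 (H₀.abs_base_change_le (g ^ n) x₀ x)
  have h4 := abs_le.1 (hβ g n)
  rw [abs_le] at *
  constructor <;> linarith

theorem IsBusemannQuasicharacter.eq [Nonempty X] {ξ : VisualBoundary X} {β β' : Γ → ℝ}
    (h : IsBusemannQuasicharacter ξ β) (h' : IsBusemannQuasicharacter ξ β') : β = β' := by
  obtain ⟨k, hk⟩ := horokernels_nonempty ξ
  obtain ⟨x⟩ := ‹Nonempty X›
  ext g
  exact tendsto_nhds_unique (h k hk x g) (h' k hk x g)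

theorem eq_zero_of_forall_nat_mul_le {a B : ℝ} (h : ∀ n : ℕ, |n * a| ≤ B) : a = 0 := by
  have := tendsto_div_of_abs_sub_le (q := fun _ => 0) (C := B) (l := a) (by simpa using h)
  simpa using tendsto_nhds_unique this (by simp)

/-- A Busemann quasicharacter which is bounded on commutators is a homomorphism. -/
theorem IsQuasiHorofunction.map_mul {h : X → X → ℝ} {C : ℝ} (H : IsQuasiHorofunction Γ h C)
    {β : Γ → ℝ} {x : X} (hβ : ∀ (g : Γ) (n : ℕ), |h x (g ^ n • x) - n * β g| ≤ C) {B : ℝ}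
    (hB : ∀ c ∈ commutator Γ, |h x (c • x)| ≤ B) (g g' : Γ) : β (g * g') = β g + β g' := by
  rw [← sub_eq_zero]
  refine eq_zero_of_forall_nat_mul_le (B := B + 5 * C) fun n => ?_
  -- The defect between `(g * g') ^ n` and `g ^ n * g' ^ n` is a commutator, so `n` times the
  -- additivity defect of `β` is bounded independently of `n`.
  set c := (g ^ n * g' ^ n)⁻¹ * (g * g') ^ n with hc
  have hcm : c ∈ commutator Γ := by
    rw [← Abelianization.ker_of, MonoidHom.mem_ker, hc]
    simp only [_root_.map_mul, map_inv, map_pow, mul_pow, inv_mul_cancel]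
  have e : (g * g') ^ n = g ^ n * g' ^ n * c := by rw [hc]; group
  have h1 := abs_le.1 (hB c hcm)
  have h2 := abs_le.1 (hβ (g * g') n)
  have h3 := abs_le.1 (hβ g n)
  have h4 := abs_le.1 (hβ g' n)
  have h5 := abs_le.1 (H.abs_mul_sub_le (g ^ n * g' ^ n) c x)
  have h6 := abs_le.1 (H.abs_mul_sub_le (g ^ n) (g' ^ n) x)
  rw [← e] at h5
  rw [abs_le]
  constructor <;> linarith

end Action

end Boundary

/-! ### Discrete paths along geodesics -/

/-- Sample a geodesic at integer times, replacing interior samples by points of the coarsely dense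
family `f` and keeping the two ends exact. -/
theorem IsGeodesicSpace.exists_discrete_path {X : Type*} [MetricSpace X] (hgeod : IsGeodesicSpace X)
    {G : Type*} {f : G → X} {R : ℝ} (hR : 0 ≤ R) (hf : ∀ y, ∃ g, dist (f g) y ≤ R) (a b : G) :
    ∃ (N : ℕ) (p : ℕ → G), p 0 = a ∧ p N = b ∧ (N : ℝ) ≤ dist (f a) (f b) + 2 ∧
      (∀ k < N, dist (f (p k)) (f (p (k + 1))) ≤ 2 * R + 1) ∧
      (∀ k l, k ≤ l → l ≤ N → (l : ℝ) - k ≤ dist (f (p k)) (f (p l)) + (2 * R + 2)) ∧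
      ∀ k ≤ N, dist (f a) (f (p k)) + dist (f (p k)) (f b) ≤ dist (f a) (f b) + 2 * R := by
  obtain ⟨γ, h0, h1, hγ⟩ := hgeod (f a) (f b)
  set L := dist (f a) (f b) with hL
  have hL0 : 0 ≤ L := dist_nonneg
  choose q hq using hf
  -- The extra `1` keeps the indices `0` and `N` distinct when `L = 0`, so that `p` can take both
  -- prescribed ends.
  set N := ⌈L⌉₊ + 1 with hN
  set τ : ℕ → ℝ := fun k => min (k : ℝ) L with hτ
  have hNL : (N : ℝ) ≤ L + 2 := by
    have := Nat.ceil_lt_add_one hL0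
    rw [hN]; push_cast; linarith
  have hτmem : ∀ k, τ k ∈ Set.Icc (0 : ℝ) L := fun k => ⟨le_min (by positivity) hL0, min_le_right _ _⟩
  have hτN : τ N = L := min_eq_right (by
    have := Nat.le_ceil L
    rw [hN]; push_cast; linarith)
  set p : ℕ → G := fun k => if k = 0 then a else if k = N then b else q (γ (τ k)) with hp
  have hp0 : p 0 = a := by simp [hp]
  have hpN : p N = b := by simp [hp, hN]
  have hclose : ∀ k, dist (f (p k)) (γ (τ k)) ≤ R := by
    intro k
    rcases eq_or_ne k 0 with rfl | hk
    · rw [hp0, ← h0]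
      have : τ 0 = 0 := by simp [hτ, hL0]
      rw [this, dist_self]; exact hR
    · rcases eq_or_ne k N with rfl | hk'
      · rw [hpN, hτN, h1, dist_self]; exact hR
      · simp only [hp, if_neg hk, if_neg hk']
        exact hq _
  have hτdist : ∀ k l, dist (γ (τ k)) (γ (τ l)) = |τ k - τ l| := fun k l =>
    hγ _ (hτmem k) _ (hτmem l)
  have hle : ∀ k l, dist (f (p k)) (f (p l)) ≤ |τ k - τ l| + 2 * R := by
    intro k l
    have e1 := dist_triangle4 (f (p k)) (γ (τ k)) (γ (τ l)) (f (p l))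
    have e2 := hclose k
    have e3 := hclose l
    rw [dist_comm] at e3
    rw [hτdist] at e1
    linarith
  have hge : ∀ k l, |τ k - τ l| ≤ dist (f (p k)) (f (p l)) + 2 * R := by
    intro k l
    have e1 := dist_triangle4 (γ (τ k)) (f (p k)) (f (p l)) (γ (τ l))
    have e2 := hclose k
    have e3 := hclose l
    rw [dist_comm] at e2
    rw [hτdist] at e1
    linarith
  refine ⟨N, p, hp0, hpN, hNL, fun k hk => ?_, fun k l hkl hl => ?_, fun k hk => ?_⟩
  · refine (hle k (k + 1)).trans ?_
    have : |τ k - τ (k + 1)| ≤ 1 := by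
      refine (abs_min_sub_min_le_max _ _ _ _).trans ?_
      simp
    linarith
  · have e1 := hge k l
    have e2 : τ k ≤ k := min_le_left _ _
    have e3 : (l : ℝ) - 2 ≤ τ l := by
      have : (l : ℝ) ≤ N := by exact_mod_cast hl
      exact le_min (by linarith) (by linarith)
    have e4 := neg_abs_le (τ k - τ l)
    linarith
  · have e1 : dist (f a) (f (p k)) ≤ τ k + R := by
      have := dist_triangle (f a) (γ (τ k)) (f (p k))
      have e2 := hγ 0 ⟨le_rfl, hL0⟩ _ (hτmem k)
      rw [h0, zero_sub, abs_neg, abs_of_nonneg (hτmem k).1] at e2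
      have := hclose k
      rw [dist_comm] at this
      linarith
    have e2 : dist (f (p k)) (f b) ≤ L - τ k + R := by
      have := dist_triangle (f (p k)) (γ (τ k)) (f b)
      have e2 := hγ _ (hτmem k) L ⟨hL0, le_rfl⟩
      rw [h1, abs_sub_comm, abs_of_nonneg (by linarith [(hτmem k).2])] at e2
      have := hclose k
      linarith
    linarith

/-! ### The extension of the commutator subgroup -/

section Extension

open CyclicExtension

variable {Γ : Type*} [Group Γ] {X : Type*} [MetricSpace X] [MulAction Γ X]

theorem commutatorExtensionHom_apply (α : Γ)
    (g : CyclicExtension (MulAut.conjNormal α : MulAut (commutator Γ))) :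
    commutatorExtensionHom α g = (g.left : Γ) * α ^ height g := rfl

theorem conjNormal_pow_apply (α : Γ) (n : ℕ) (c : commutator Γ) :
    (((MulAut.conjNormal α : MulAut (commutator Γ)) ^ n) c : Γ) = α ^ n * c * (α ^ n)⁻¹ := by
  rw [← map_pow, MulAut.conjNormal_apply]

theorem commutator_of_conj (g s : Γ) : s * g * s⁻¹ * g⁻¹ ∈ commutator Γ := by
  rw [← Abelianization.ker_of, MonoidHom.mem_ker]
  simp only [map_mul, map_inv]
  rw [mul_comm (Abelianization.of s)]
  group

variable [IsIsometricSMul Γ X]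

/-- Conjugating by `α ^ n` amounts to moving the base point to `α ^ (-n) x`; this translates
confinement into the decrease of displacements along a ray. -/
theorem dist_conjNormal_pow_smul (α : Γ) (n : ℕ) (c : commutator Γ) (x : X) :
    dist x ((((MulAut.conjNormal α : MulAut (commutator Γ)) ^ n) c : Γ) • x) =
      dist ((α ^ n)⁻¹ • x) ((c : Γ) • (α ^ n)⁻¹ • x) := by
  rw [conjNormal_pow_apply, ← dist_smul (α ^ n) ((α ^ n)⁻¹ • x)]
  simp only [smul_smul, mul_inv_cancel, one_smul, mul_assoc]

theorem dist_inv_smul (g : Γ) (x : X) : dist x (g⁻¹ • x) = dist x (g • x) := by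
  rw [← dist_smul g, smul_inv_smul, dist_comm]

theorem dist_zpow_smul_le (α : Γ) (x : X) (n : ℤ) :
    dist x (α ^ n • x) ≤ |(n : ℝ)| * dist x (α • x) := by
  have hn : ∀ n : ℕ, dist x (α ^ n • x) ≤ n * dist x (α • x) := by
    intro n
    induction n with
    | zero => simp
    | succ n ih =>
      have := dist_triangle x (α ^ n • x) (α ^ (n + 1) • x)
      rw [pow_succ, mul_smul, dist_smul] at this
      rw [pow_succ, mul_smul]
      push_cast
      linarith
  rcases Int.eq_nat_or_neg n with ⟨m, rfl | rfl⟩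
  · simpa using hn m
  · rw [zpow_neg, dist_inv_smul]
    simpa using hn m

/-- A Švarc–Milnor argument. -/
theorem inclusionIsQuasiIsometry_of_bounds (hgeod : IsGeodesicSpace X) {α : Γ}
    {A : Set (commutator Γ)} (hconf : IsConfining (MulAut.conjNormal α : MulAut (commutator Γ)) A)
    (hA : ∀ a ∈ A, a⁻¹ ∈ A) {x : X} {R : ℝ} (hbdd : ∀ a ∈ A, dist x ((a : Γ) • x) ≤ R)
    {R' : ℝ} (hdense : ∀ y, ∃ g, dist (commutatorExtensionHom α g • x) y ≤ R')
    (hproper : ∀ T : ℝ, ∃ n : ℝ, ∀ g, dist x (commutatorExtensionHom α g • x) ≤ T →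
      wordDist (confiningGenerators (MulAut.conjNormal α) A) 1 g ≤ n) :
    InclusionIsQuasiIsometry α A x := by
  set φ : MulAut (commutator Γ) := MulAut.conjNormal α with hφ
  set S := confiningGenerators φ A with hS
  set ι := commutatorExtensionHom α with hι
  have hgen := hconf.wordGenerates
  have hR' : 0 ≤ R' := by
    obtain ⟨g, hg⟩ := hdense x
    exact dist_nonneg.trans hg
  -- Consecutive points of a discrete path are at distance at most `2 * R' + 1`, so `n` bounds the
  -- word length of one step.
  obtain ⟨n, hn⟩ := hproper (2 * R' + 1)
  have hn0 : 0 ≤ n := hgen.isPseudoDist.nonneg _ _ |>.trans (hn 1 (by simp; linarith))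
  set M := max R (dist x (α • x)) with hM
  have hM0 : 0 ≤ M := le_max_of_le_right dist_nonneg
  have hup : ∀ l : List (CyclicExtension φ), (∀ s ∈ l, s ∈ S) →
      dist x (ι l.prod • x) ≤ M * l.length := by
    intro l hl
    induction l with
    | nil => simp
    | cons s l ih =>
      have h1 := ih fun t ht => hl t (List.mem_cons_of_mem _ ht)
      have h2 : dist x (ι s • x) ≤ M := by
        rcases hl s List.mem_cons_self with ⟨a, ha, rfl⟩ | rfl | rfl
        · refine (Eq.le ?_).trans ((hbdd a ha).trans (le_max_left _ _))
          have : ι (SemidirectProduct.inl a) = a := by simp [hι, commutatorExtensionHom]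
          rw [this]
        · refine (Eq.le ?_).trans (le_max_right _ _)
          have : ι (SemidirectProduct.inr (Multiplicative.ofAdd 1)) = α := by
            simp [hι, commutatorExtensionHom]
          rw [this]
        · refine (Eq.le ?_).trans (le_max_right _ _)
          have : ι (SemidirectProduct.inr (Multiplicative.ofAdd (-1))) = α⁻¹ := by
            simp [hι, commutatorExtensionHom]
          rw [this, dist_inv_smul]
      have h3 := dist_triangle x (ι s • x) (ι (s * l.prod) • x)
      rw [map_mul, mul_smul, dist_smul] at h3
      rw [List.prod_cons, List.length_cons, map_mul, mul_smul]
      push_cast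
      linarith
  refine ⟨1 + M + (n + 2) + R' + (n + 2), by linarith, fun y y' => ?_, fun z => ?_⟩
  · set C := 1 + M + (n + 2) + R' + (n + 2) with hC
    have hC1 : 1 ≤ C := by linarith
    constructor
    · have h1 : wordDist S y y' ≤ n * (dist (ι y • x) (ι y' • x) + 2) := by
        obtain ⟨N, p, hp0, hpN, hN, hstep, -, -⟩ :=
          hgeod.exists_discrete_path (f := fun g => ι g • x) hR' hdense y y'
        have : ∀ k ≤ N, wordDist S (p 0) (p k) ≤ n * k := by
          intro k hk
          induction k with
          | zero => rw [hgen.isPseudoDist.self]; simp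
          | succ k ih =>
            have e1 := ih (by omega)
            have e2 := hstep k (by omega)
            have e3 := hgen.isPseudoDist.triangle (p 0) (p k) (p (k + 1))
            have e4 := hn ((p k)⁻¹ * p (k + 1)) (by
              rw [map_mul, map_inv, mul_smul, ← dist_smul (ι (p k)), smul_inv_smul]
              exact e2)
            rw [← wordDist_mul_left _ (p k), mul_one, mul_inv_cancel_left] at e4
            push_cast
            linarith
        have h2 := this N le_rfl
        rw [hp0, hpN] at h2
        exact h2.trans (by gcongr)
      have h2 : C⁻¹ * wordDist S y y' ≤ C⁻¹ * (C * (dist (ι y • x) (ι y' • x) + 2)) := by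
        have : n ≤ C := by linarith
        have := dist_nonneg (x := ι y • x) (y := ι y' • x)
        gcongr
        exact h1.trans (by gcongr)
      rw [inv_mul_cancel_left₀ (by linarith)] at h2
      have : 2 ≤ C := by linarith
      simp only [orbitDist]
      linarith
    · obtain ⟨l, hl, hlS, hlp⟩ := hgen.exists_list (y⁻¹ * y')
      have h1 := hup l fun s hs => mem_confiningGenerators_of_inv hA (hlS s hs)
      rw [hlp, hl, map_mul, map_inv, mul_smul, ← dist_smul (ι y), smul_inv_smul] at h1
      have h2 : M * wordDist S y y' ≤ C * wordDist S y y' := by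
        have := hgen.isPseudoDist.nonneg y y'
        have : M ≤ C := by linarith
        gcongr
      simp only [orbitDist]
      simp only [wordDist] at h2 ⊢
      linarith
  · obtain ⟨g, hg⟩ := hdense (z • x)
    exact ⟨g, hg.trans (by linarith)⟩

end Extension

/-! ### From regular focal actions to confining automorphisms -/

section HomToReal

variable {Γ : Type*} [Group Γ] {β : Γ → ℝ}

/-- An additive real-valued function on a group, as a homomorphism. -/
def multiplicativeHom (hmul : ∀ g g' : Γ, β (g * g') = β g + β g') : Γ →* Multiplicative ℝ :=
  MonoidHom.mk' (fun g => Multiplicative.ofAdd (β g)) fun g g' => by rw [hmul]; rfl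

theorem additive_zpow (hmul : ∀ g g' : Γ, β (g * g') = β g + β g') (g : Γ) (n : ℤ) :
    β (g ^ n) = n * β g := by
  have h : Multiplicative.toAdd (multiplicativeHom hmul (g ^ n)) =
      n • Multiplicative.toAdd (multiplicativeHom hmul g) := by
    rw [map_zpow]; rfl
  rw [zsmul_eq_mul] at h
  exact h

theorem additive_pow (hmul : ∀ g g' : Γ, β (g * g') = β g + β g') (g : Γ) (n : ℕ) :
    β (g ^ n) = n * β g := by
  simpa using additive_zpow hmul g n

theorem additive_inv (hmul : ∀ g g' : Γ, β (g * g') = β g + β g') (g : Γ) : β g⁻¹ = -β g := by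
  simpa using additive_zpow hmul g (-1)

theorem additive_commutator (hmul : ∀ g g' : Γ, β (g * g') = β g + β g') {c : Γ}
    (hc : c ∈ commutator Γ) : β c = 0 := by
  have h := Abelianization.commutator_subset_ker (multiplicativeHom hmul) hc
  rw [MonoidHom.mem_ker] at h
  exact congrArg Multiplicative.toAdd h

end HomToReal

section Focal

variable {Γ : Type*} [Group Γ] {X : Type*} [MetricSpace X] [MulAction Γ X] [IsIsometricSMul Γ X]

/-- As `|h| ≤ dist`, this makes `n ↦ s ^ n • x` a rough geodesic of speed `b`. In the induction,
`dist_le` through `s ^ n • x` offers two bounds; `3 * C ≤ b` ensures that the errors never exceed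
the gain of `b` per step. -/
theorem IsQuasiHorofunction.exists_dist_pow_le {h : X → X → ℝ} {C : ℝ}
    (H : IsQuasiHorofunction Γ h C) {s : Γ} {x : X} {b : ℝ}
    (hb : ∀ n : ℕ, |h x (s ^ n • x) - n * b| ≤ C) (hbC : 3 * C ≤ b) :
    ∃ E : ℝ, 0 ≤ E ∧ ∀ n : ℕ, dist x (s ^ n • x) ≤ n * b + E := by
  have hC := H.nonneg
  refine ⟨dist x (s • x) + 2 * C, by positivity, fun n => ?_⟩
  induction n with
  | zero => simp; positivity
  | succ n ih =>
    have h1 := H.dist_le x (s ^ (n + 1) • x) (s ^ n • x)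
    have h2 : dist (s ^ (n + 1) • x) (s ^ n • x) = dist x (s • x) := by
      rw [pow_succ, mul_smul, dist_smul, dist_comm]
    have h3 := abs_le.1 (hb n)
    have h4 := abs_le.1 (hb 1)
    have h5 := abs_le.1 (H.quasi_invariant (s ^ n) x (s • x))
    rw [← mul_smul, ← pow_succ] at h5
    have h6 := H.swap (s ^ n • x) (s ^ (n + 1) • x)
    rw [pow_one, Nat.cast_one, one_mul] at h4
    rw [h2] at h1
    push_cast
    rcases max_cases (dist x (s ^ n • x) + h (s ^ (n + 1) • x) (s ^ n • x))
      (dist x (s • x) + h x (s ^ n • x)) with ⟨e, -⟩ | ⟨e, -⟩ <;> rw [e] at h1 <;> linarith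

/-- Displacements decrease at speed `2` along a ray going to the fixed point at infinity. -/
theorem IsQuasiHorofunction.dist_pow_smul_le {h : X → X → ℝ} {C : ℝ}
    (H : IsQuasiHorofunction Γ h C) {s : Γ} {x : X} {b : ℝ}
    (hb : ∀ n : ℕ, |h x (s ^ n • x) - n * b| ≤ C) {E : ℝ} (hE0 : 0 ≤ E)
    (hE : ∀ n : ℕ, dist x (s ^ n • x) ≤ n * b + E) {g : Γ} {t : ℝ}
    (ht : |h x (g • x) - t| ≤ C) (n : ℕ) :
    dist (s ^ n • x) (g • s ^ n • x) ≤
      max |t| (dist x (g • x) - n * (2 * b)) + (E + 5 * C) := by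
  have hC := H.nonneg
  -- Each application of `dist_le` moves one of the two points by `n * b` towards infinity; together
  -- they gain `2 * n * b`, until `|t|` takes over.
  have h1 := H.dist_le x (g • s ^ n • x) (g • x)
  have h2 := H.dist_le (s ^ n • x) (g • s ^ n • x) x
  have h3 := hE n
  have h4 := abs_le.1 (hb n)
  have h5 := abs_le.1 (H.quasi_invariant g x (s ^ n • x))
  have h6 := abs_le.1 ht
  have h7 := H.cocycle x (g • x) (g • s ^ n • x)
  have h8 := H.swap (g • x) (g • s ^ n • x)
  have h9 := H.swap x (g • s ^ n • x)
  have h10 := H.swap x (s ^ n • x)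
  rw [dist_smul, dist_comm (s ^ n • x)] at h1
  rw [dist_comm (s ^ n • x) x, dist_comm _ x] at h2
  have e1 := le_max_left |t| (dist x (g • x) - n * (2 * b))
  have e2 := le_max_right |t| (dist x (g • x) - n * (2 * b))
  have e3 := le_abs_self t
  have e4 := neg_abs_le t
  rcases max_cases (dist x (s ^ n • x) + h (g • s ^ n • x) x)
    (dist x (g • s ^ n • x) + h (s ^ n • x) x) with ⟨e, -⟩ | ⟨e, -⟩ <;> rw [e] at h2
  · linarith
  · rcases max_cases (dist x (g • x) + h (g • s ^ n • x) (g • x))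
      (dist x (s ^ n • x) + h x (g • x)) with ⟨e, -⟩ | ⟨e, -⟩ <;> rw [e] at h1 <;> linarith

/-! ### Boundary points of linearly diverging sequences -/

theorem gromovProduct_ge_sub (x y z : X) : dist x z - dist y z ≤ gromovProduct dist x y z := by
  have := dist_triangle x y z
  simp only [gromovProduct]
  linarith

theorem isCauchyGromov_of_linear {v : ℕ → X} {x : X} {b C E : ℝ} (hb : 0 < b)
    (hvx : ∀ n : ℕ, n * b - C ≤ dist x (v n))
    (hvv : ∀ n m : ℕ, n ≤ m → dist (v n) (v m) ≤ ((m : ℝ) - n) * b + E) : IsCauchyGromov v := by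
  have hmain : ∀ n m : ℕ, n ≤ m → n * b - C - E / 2 ≤ gromovProduct dist x (v n) (v m) := by
    intro n m hnm
    have h1 := hvx n
    have h2 := hvx m
    have h3 := hvv n m hnm
    simp only [gromovProduct]
    linarith
  refine isCauchyGromov_of_forall x fun T => ?_
  obtain ⟨N, hN⟩ := exists_nat_ge ((T + C + E / 2) / b)
  rw [div_le_iff₀ hb] at hN
  refine ⟨N, fun n hn m hm => ?_⟩
  rcases le_total n m with hnm | hnm
  · have : (N : ℝ) * b ≤ n * b := by gcongr
    linarith [hmain n m hnm]
  · have : (N : ℝ) * b ≤ m * b := by gcongr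
    rw [gromovProduct_dist_comm]
    linarith [hmain m n hnm]

/-- The product of `g • v n` and `v n` is at least `dist x (v n) - F`, which tends to infinity. -/
theorem smul_mk_eq_of_bounded {δ : ℝ} (hX : FourPoint (dist : X → X → ℝ) δ) {v : ℕ → X} {x : X}
    {b C F : ℝ} (hb : 0 < b) (hvx : ∀ n : ℕ, n * b - C ≤ dist x (v n)) (hv : IsCauchyGromov v)
    {g : Γ} (hF : ∀ n, dist (g • v n) (v n) ≤ F) :
    (Quot.mk (CauchyGromovRel X) ⟨fun n => g • v n, hv.smul g⟩) =
      Quot.mk (CauchyGromovRel X) ⟨v, hv⟩ := by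
  refine (visualBoundary_mk_eq_iff hX).2 ?_
  refine cauchyGromovRel_of_frequently hX x fun T N => ?_
  obtain ⟨n, hn⟩ := exists_nat_ge ((T + C + F) / b)
  rw [div_le_iff₀ hb] at hn
  refine ⟨max n N, le_max_right _ _, max n N, le_max_right _ _, ?_⟩
  generalize hk : max n N = k
  have hnk : (n : ℝ) * b ≤ k * b := by
    have : n ≤ k := by omega
    gcongr
  have h1 := gromovProduct_ge_sub x (g • v k) (v k)
  have h2 := hvx k
  have h3 := hF k
  simp only
  linarith

/-- If the commutator subgroup has bounded orbits, the repelling point of an element translating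
towards `ξ` is a second fixed point. -/
theorem IsFocalAt.not_bounded_commutator {δ : ℝ} (hX : FourPoint (dist : X → X → ℝ) δ)
    {ξ : VisualBoundary X} (hξ : IsFocalAt Γ ξ) {h : X × X → ℝ} (hh : h ∈ horokernels ξ) {C : ℝ}
    {s : Γ} {x : X} {b : ℝ} (hb0 : 0 < b)
    (hb' : ∀ n : ℕ, |h (x, (s ^ n)⁻¹ • x) + n * b| ≤ C) {E : ℝ}
    (hE : ∀ n : ℕ, dist x (s ^ n • x) ≤ n * b + E)
    (hdist : ∀ y, |h (x, y)| ≤ dist x y) (R : ℝ) :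
    ¬ ∀ c ∈ commutator Γ, dist x (c • x) ≤ R := by
  intro hR
  set v : ℕ → X := fun n => (s ^ n)⁻¹ • x with hv
  have hvx : ∀ n, n * b - C ≤ dist x (v n) := by
    intro n
    have h1 := (abs_le.1 (hb' n)).2
    have h2 := neg_abs_le (h (x, v n))
    have h3 := hdist (v n)
    simp only [hv] at *
    linarith
  have hvv : ∀ n m, n ≤ m → dist (v n) (v m) ≤ ((m : ℝ) - n) * b + E := by
    intro n m hnm
    have h1 := hE (m - n)
    rw [Nat.cast_sub hnm] at h1
    refine (Eq.le ?_).trans h1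
    obtain ⟨k, rfl⟩ := Nat.exists_eq_add_of_le hnm
    rw [add_tsub_cancel_left]
    simp only [hv]
    rw [pow_add, mul_inv_rev, mul_smul, ← dist_smul (s ^ (n + k)), pow_add]
    simp only [smul_smul]
    rw [dist_comm]
    congr 1
    · group; simp
    · rw [← pow_add, add_comm, pow_add]; group
  have hvC : IsCauchyGromov v := isCauchyGromov_of_linear hb0 hvx hvv
  obtain ⟨η, hη⟩ : ∃ η : VisualBoundary X, Quot.mk (CauchyGromovRel X) ⟨v, hvC⟩ = η := ⟨_, rfl⟩
  have hfix : ∀ g : Γ, g • η = η := by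
    intro g
    rw [← hη]
    refine smul_mk_eq_of_bounded hX hb0 hvx (hvC) (F := R + dist x (g • x)) fun k => ?_
    have h3 := hR _ (commutator_of_conj g (s ^ k))
    have h4 : dist (g • v k) (v k) = dist x ((s ^ k * g * (s ^ k)⁻¹ * g⁻¹) • g • x) := by
      rw [dist_comm, ← dist_smul (s ^ k)]
      simp only [hv, smul_smul, mul_inv_cancel, one_smul]
      congr 2
      group
    have h5 := dist_triangle x ((s ^ k * g * (s ^ k)⁻¹ * g⁻¹) • x)
      ((s ^ k * g * (s ^ k)⁻¹ * g⁻¹) • g • x)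
    rw [dist_smul] at h5
    linarith
  have hvξ := hη.trans (hξ.2.1 _ hfix)
  -- `h (x, v k)` is about `-k * b`, since `v` moves away from `ξ`. If `v` represented `ξ`, it would
  -- also be about `dist x (v n) - dist (v k) (v n)`, roughly `k * b`.
  obtain ⟨k, hk⟩ := exists_nat_gt ((2 * C + E + 2 * δ) / (2 * b))
  rw [div_lt_iff₀ (by positivity)] at hk
  obtain ⟨n, hn, hkn⟩ := ((eventually_abs_sub_horokernel_le hX hh hvξ x (v k)).and
    (eventually_ge_atTop k)).exists
  have h1 := hvx n
  have h2 := hvv k n hkn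
  have h3 := (abs_le.1 hn).2
  have h4 := (abs_le.1 (hb' k)).2
  simp only at h3
  simp only [hv] at *
  linarith

theorem exists_isConfiningPair [Nonempty X] (hgeod : IsGeodesicSpace X)
    (hcob : IsCoboundedAction Γ X) {δ : ℝ} (hX : FourPoint (dist : X → X → ℝ) δ)
    (hreg : IsRegularFocal Γ X) :
    ∃ (α : Γ) (A : Set (commutator Γ)), IsConfiningPair X α A := by
  obtain ⟨ξ, hξ, β, hβ, hmul⟩ := hreg
  obtain ⟨h, hh⟩ := horokernels_nonempty ξ
  have H := isQuasiHorofunction_of_mem_horokernels hX hξ.1 hh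
  set C := 4 * δ with hC
  have hC0 := H.nonneg
  obtain ⟨x, Rc, hRc⟩ := hcob
  have hβh : ∀ (g : Γ) (n : ℕ), |h (x, g ^ n • x) - n * β g| ≤ C := fun g n =>
    H.abs_sub_le_of_tendsto (hβ h hh x g) n
  have hβ1 : ∀ g : Γ, |h (x, g • x) - β g| ≤ C := fun g => by simpa using hβh g 1
  obtain ⟨s₀, hs₀⟩ : ∃ s₀ : Γ, 0 < β s₀ := by
    obtain ⟨g, hg⟩ := hξ.2.2
    have := H.ne_zero_of_isHyperbolicIsometry hg x (hβh g)
    rcases lt_or_gt_of_ne this with h' | h'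
    · exact ⟨g⁻¹, by rw [additive_inv hmul]; linarith⟩
    · exact ⟨g, h'⟩
  obtain ⟨s, b, hsb, hb0, hbC⟩ : ∃ (s : Γ) (b : ℝ), β s = b ∧ 0 < b ∧ 3 * C ≤ b := by
    obtain ⟨k, hk⟩ := exists_nat_ge (3 * C / β s₀)
    rw [div_le_iff₀ hs₀] at hk
    refine ⟨s₀ ^ (k + 1), _, rfl, ?_, ?_⟩ <;> rw [additive_pow hmul] <;> push_cast
    · positivity
    · linarith
  have hs : ∀ n : ℕ, |h (x, s ^ n • x) - n * b| ≤ C := fun n => hsb ▸ hβh s n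
  obtain ⟨E, hE0, hE⟩ := H.exists_dist_pow_le hs hbC
  set C₁ := E + 5 * C with hC₁
  have hC₁0 : 0 ≤ C₁ := by positivity
  have hcontract : ∀ (g : Γ) (n : ℕ), dist (s ^ n • x) (g • s ^ n • x) ≤
      max |β g| (dist x (g • x) - n * (2 * b)) + C₁ := fun g n =>
    H.dist_pow_smul_le hs hE0 hE (hβ1 g) n
  -- Chosen so that one conjugation by `α` lowers displacements by `L ≥ C₁`, the threshold defining
  -- `A`. Since `s` moves towards `ξ`, `α` has to be a power of its inverse.
  obtain ⟨K, hK⟩ := exists_nat_ge (C₁ / (2 * b))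
  rw [div_le_iff₀ (by positivity)] at hK
  set L := ((K : ℝ) + 1) * (2 * b) with hL
  have hL0 : 0 < L := by positivity
  have hLC : C₁ ≤ L := by rw [hL]; linarith
  set α := (s ^ (K + 1))⁻¹ with hα
  have hαβ : β α = -(L / 2) := by
    rw [hα, additive_inv hmul, additive_pow hmul, hsb, hL]; push_cast; ring
  set φ : MulAut (commutator Γ) := MulAut.conjNormal α with hφ
  have hφdist : ∀ (n : ℕ) (c : commutator Γ), dist x (((φ ^ n) c : Γ) • x) ≤
      max 0 (dist x ((c : Γ) • x) - n * L) + C₁ := by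
    intro n c
    rw [hφ, dist_conjNormal_pow_smul, hα, inv_pow, inv_inv, ← pow_mul]
    refine (hcontract c _).trans (Eq.le ?_)
    rw [additive_commutator hmul c.2, abs_zero, hL]
    push_cast
    ring_nf
  set A : Set (commutator Γ) := {c | dist x ((c : Γ) • x) ≤ C₁} with hA
  have hAinv : ∀ a ∈ A, a⁻¹ ∈ A := by
    intro a ha
    change dist x ((a : Γ)⁻¹ • x) ≤ C₁
    rw [dist_inv_smul]
    exact ha
  -- The exponent `2` suffices for products: they move `x` by at most `2 * C₁ ≤ 2 * L`, and two
  -- conjugations subtract `2 * L`.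
  have hconf : IsConfining φ A := by
    refine ⟨?_, fun c => ?_, 2, fun a ha a' ha' => ?_⟩
    · rintro _ ⟨a, ha, rfl⟩
      have h1 := hφdist 1 a
      change dist x ((φ a : Γ) • x) ≤ C₁
      rw [max_eq_left] at h1
      · simpa using h1
      · have : dist x ((a : Γ) • x) ≤ C₁ := ha
        push_cast; linarith
    · obtain ⟨n, hn⟩ := exists_nat_ge (dist x ((c : Γ) • x) / L)
      rw [div_le_iff₀ hL0] at hn
      refine ⟨n, ?_⟩
      have h1 := hφdist n c
      rwa [max_eq_left (by linarith), zero_add] at h1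
    · have h1 := hφdist 2 (a * a')
      have h2 : dist x ((a : Γ) • x) ≤ C₁ := ha
      have h3 : dist x ((a' : Γ) • x) ≤ C₁ := ha'
      have h4 := dist_triangle x ((a : Γ) • x) ((a : Γ) • (a' : Γ) • x)
      rw [dist_smul] at h4
      rw [Subgroup.coe_mul, mul_smul, max_eq_left (by push_cast; linarith), zero_add] at h1
      exact h1
  refine ⟨α, A, ?_, hAinv, ⟨hconf, ?_⟩, x, ?_⟩
  · rw [isOfFinOrder_iff_pow_eq_one]
    rintro ⟨n, hn, e⟩
    rw [← map_pow, ← MonoidHom.mem_ker, Abelianization.ker_of] at e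
    have h1 := additive_commutator hmul e
    rw [additive_pow hmul, hαβ] at h1
    have hn' : (0 : ℝ) < n := by exact_mod_cast hn
    nlinarith
  -- If `φ '' A = A`, pulling back by `φ` never leaves `A`, so `A` is the whole commutator subgroup,
  -- which then has bounded orbits.
  · intro heq
    have hall : ∀ (n : ℕ) (c : commutator Γ), (φ ^ n) c ∈ A → c ∈ A := by
      intro n
      induction n with
      | zero => intro c hc; simpa using hc
      | succ n ih =>
        intro c hc
        rw [pow_succ', MulAut.mul_apply, ← heq] at hc
        obtain ⟨a, ha, e⟩ := hc
        rw [φ.injective e] at ha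
        exact ih c ha
    refine hξ.not_bounded_commutator (C := C) hX hh hb0 (fun n => ?_) hE (H.abs_le_dist x) C₁ ?_
    · have := hβ1 (s ^ n)⁻¹
      rw [additive_inv hmul, additive_pow hmul, hsb] at this
      simpa using this
    · intro c hc
      obtain ⟨n, hn⟩ := hconf.2.1 ⟨c, hc⟩
      exact hall n ⟨c, hc⟩ hn
  · refine inclusionIsQuasiIsometry_of_bounds hgeod hconf hAinv (R := C₁) (fun a ha => ha)
      (R' := L + C₁ + Rc) ?_ ?_
    · intro y
      obtain ⟨γ, hγ⟩ := hRc y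
      -- Dividing by a power of `α` makes `β γ'` bounded.
      set n : ℤ := ⌊β γ / β α⌋ with hn
      set γ' := α ^ (-n) * γ with hγ'
      have hγβ : |β γ'| ≤ L := by
        have h1 := Int.floor_le (β γ / β α)
        have h2 := Int.lt_floor_add_one (β γ / β α)
        rw [← hn] at h1 h2
        have h3 : β γ = β γ / β α * β α := by
          field_simp [show β α ≠ 0 by rw [hαβ]; linarith]
        rw [hγ', hmul, additive_zpow hmul, h3, hαβ] at *
        push_cast
        rw [abs_le]
        constructor <;> nlinarith
      obtain ⟨N, hN⟩ := exists_nat_ge (dist x (γ'⁻¹ • x) / (2 * b))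
      rw [div_le_iff₀ (by positivity)] at hN
      have h1 := hcontract γ'⁻¹ N
      rw [additive_inv hmul, abs_neg] at h1
      have h2 := h1.trans (add_le_add_left (max_le le_rfl (by
        have := abs_nonneg (β γ')
        linarith)) _)
      -- The distance between `c • x` and `γ' • x` is the displacement of `s ^ N • x` by `γ'⁻¹`,
      -- which for large `N` is at most `|β γ'| + C₁`.
      set c : commutator Γ := ⟨γ' * (s ^ N)⁻¹ * γ'⁻¹ * ((s ^ N)⁻¹)⁻¹, commutator_of_conj _ _⟩
      refine ⟨CyclicExtension.power φ n * CyclicExtension.base φ c, ?_⟩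
      have h3 : commutatorExtensionHom α (CyclicExtension.power φ n * CyclicExtension.base φ c) =
          α ^ n * c := by
        rw [map_mul]
        change ((1 : commutator Γ) : Γ) * α ^ n * ((c : Γ) * α ^ (0 : ℤ)) = _
        simp
      have h4 : dist ((α ^ n * (c : Γ)) • x) (γ • x) = dist (s ^ N • x) (γ'⁻¹ • s ^ N • x) := by
        rw [← dist_smul (s ^ N * γ'⁻¹ * (α ^ n)⁻¹), dist_comm (s ^ N • x)]
        simp only [smul_smul]
        congr 2
        · change s ^ N * γ'⁻¹ * (α ^ n)⁻¹ * (α ^ n * (γ' * (s ^ N)⁻¹ * γ'⁻¹ * ((s ^ N)⁻¹)⁻¹)) = _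
          group
        · rw [hγ']; group
      rw [h3]
      have h5 := dist_triangle ((α ^ n * (c : Γ)) • x) (γ • x) y
      rw [dist_comm (γ • x) y] at h5
      linarith
    · intro T
      -- The height is read off from `β`, which is bounded by displacement; once it is bounded, so
      -- is the displacement of `g.left`, hence the number of conjugations bringing it into `A`.
      set m₁ := (T + C) / (L / 2) with hm₁
      obtain ⟨k, hk⟩ := exists_nat_ge ((T + m₁ * dist x (α • x)) / L)
      rw [div_le_iff₀ hL0] at hk
      refine ⟨3 * m₁ + 2 * k + 1, fun g hg => ?_⟩
      rw [commutatorExtensionHom_apply] at hg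
      set m := CyclicExtension.height g with hm
      have hm' : |(m : ℝ)| ≤ m₁ := by
        have h1 := hβ1 ((g.left : Γ) * α ^ m)
        rw [hmul, additive_commutator hmul g.left.2, additive_zpow hmul, hαβ, zero_add] at h1
        have h2 := H.abs_le_dist x (((g.left : Γ) * α ^ m) • x)
        rw [hm₁, le_div_iff₀ (by positivity)]
        have h3 : |(m : ℝ)| * (L / 2) = |(m : ℝ) * -(L / 2)| := by
          rw [abs_mul, abs_neg, abs_of_pos (by positivity : 0 < L / 2)]
        rw [h3]
        rw [abs_le] at *
        constructor <;> linarith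
      have hc : dist x ((g.left : Γ) • x) ≤ k * L := by
        have h1 := dist_triangle x (((g.left : Γ) * α ^ m) • x) ((g.left : Γ) • x)
        rw [dist_comm (((g.left : Γ) * α ^ m) • x) ((g.left : Γ) • x), mul_smul, dist_smul] at h1
        rw [mul_smul] at hg
        have h2 := dist_zpow_smul_le α x m
        have h3 : |(m : ℝ)| * dist x (α • x) ≤ m₁ * dist x (α • x) := by gcongr
        linarith
      have hmem : (φ ^ k) g.left ∈ A := by
        have h1 := hφdist k g.left
        rw [max_eq_left (by linarith), zero_add] at h1
        exact h1
      have hlev : level A 1 g ≤ k + |m| := by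
        refine level_le ⟨?_, ?_, ?_⟩
        · rw [CyclicExtension.height_one]; positivity
        · rw [← hm]; have := neg_abs_le m; omega
        · refine hconf.zpow_mem_of_le (m := k) (by simp) ?_
          simpa using hmem
      have h1 := hconf.wordDist_le 1 g
      have h2 : (level A 1 g : ℝ) ≤ k + |(m : ℝ)| := by exact_mod_cast hlev
      have h3 := le_abs_self (m : ℝ)
      simp only [modelDist, CyclicExtension.height_one, ← hm] at h1
      push_cast at h1
      linarith

end Focal

/-! ### From confining automorphisms to regular focal actions -/

theorem FourPoint.const_mul {Y : Type*} {d : Y → Y → ℝ} {δ : ℝ} (h : FourPoint d δ) {l : ℝ}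
    (hl : 0 ≤ l) : FourPoint (fun x y => l * d x y) (l * δ) := by
  refine fourPoint_of_le_max fun w x y z => ?_
  have := mul_le_mul_of_nonneg_left (h.le_max w x y z) hl
  rw [mul_add, mul_add, mul_max_of_nonneg _ _ hl] at this
  simp only [← mul_add] at *
  linarith

section Converse

open CyclicExtension

variable {Γ : Type*} [Group Γ] {X : Type*} [MetricSpace X] [MulAction Γ X] [IsIsometricSMul Γ X]

/-! ### Orbit distances compared with the model distance -/

theorem InclusionIsQuasiIsometry.change_basepoint {α : Γ} {A : Set (commutator Γ)} {x : X}
    (h : InclusionIsQuasiIsometry α A x) (y : X) : InclusionIsQuasiIsometry α A y := by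
  have hd : ∀ g g' : Γ, |orbitDist y g g' - orbitDist x g g'| ≤ 2 * dist x y := by
    intro g g'
    have h1 := dist_triangle4 (g • y) (g • x) (g' • x) (g' • y)
    have h2 := dist_triangle4 (g • x) (g • y) (g' • y) (g' • x)
    rw [dist_smul, dist_smul, dist_comm y x] at h1
    rw [dist_smul, dist_smul, dist_comm y x] at h2
    simp only [orbitDist]
    rw [abs_le]
    constructor <;> linarith
  obtain ⟨C, hC, h1, h2⟩ := h
  have hxy := dist_nonneg (x := x) (y := y)
  set S := confiningGenerators (MulAut.conjNormal α : MulAut (commutator Γ)) A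
  refine ⟨C + 2 * dist x y, by linarith, fun g g' => ?_, fun γ => ?_⟩
  · obtain ⟨h3, h4⟩ := h1 g g'
    have h5 := abs_le.1 (hd (commutatorExtensionHom α g) (commutatorExtensionHom α g'))
    have h6 : 0 ≤ wordDist S g g' := by simp only [wordDist]; positivity
    have h7 : (C + 2 * dist x y)⁻¹ * wordDist S g g' ≤ C⁻¹ * wordDist S g g' := by
      gcongr; linarith
    have h8 : C * wordDist S g g' ≤ (C + 2 * dist x y) * wordDist S g g' := by
      gcongr; linarith
    constructor <;> linarith
  · obtain ⟨g, hg⟩ := h2 γ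
    have h5 := abs_le.1 (hd (commutatorExtensionHom α g) γ)
    exact ⟨g, by linarith⟩

theorem InclusionIsQuasiIsometry.exists_bounds (hcob : IsCoboundedAction Γ X) {α : Γ}
    {A : Set (commutator Γ)} {x : X} (h : InclusionIsQuasiIsometry α A x) :
    ∃ C : ℝ, 1 ≤ C ∧ (∀ g g', dist (commutatorExtensionHom α g • x)
        (commutatorExtensionHom α g' • x) ≤
          C * wordDist (confiningGenerators (MulAut.conjNormal α) A) g g' + C) ∧
      (∀ g g', wordDist (confiningGenerators (MulAut.conjNormal α) A) g g' ≤
        C * dist (commutatorExtensionHom α g • x) (commutatorExtensionHom α g' • x) + C * C) ∧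
      ∃ R : ℝ, 0 ≤ R ∧ ∀ y, ∃ g, dist (commutatorExtensionHom α g • x) y ≤ R := by
  obtain ⟨C, hC, h1, h2⟩ := h
  obtain ⟨x₀, R, hR⟩ := hcob
  refine ⟨C, hC, fun g g' => (h1 g g').2, fun g g' => ?_, |R| + dist x x₀ + C,
    by positivity, fun y => ?_⟩
  · have h3 := (h1 g g').1
    rw [sub_le_iff_le_add, inv_mul_le_iff₀ (by linarith)] at h3
    simp only [orbitDist] at h3
    linarith
  · obtain ⟨γ, hγ⟩ := hR y
    obtain ⟨g, hg⟩ := h2 γ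
    refine ⟨g, ?_⟩
    have h3 := dist_triangle4 (commutatorExtensionHom α g • x) (γ • x) (γ • x₀) y
    rw [dist_smul, dist_comm (γ • x₀) y] at h3
    have h4 := le_abs_self R
    simp only [orbitDist] at hg
    linarith

/-- Rough geodesics of `[Γ, Γ] ⋊ ⟨α⟩` have almost additive distances in the orbit. -/
theorem exists_dist_add_le (hgeod : IsGeodesicSpace X) (hcob : IsCoboundedAction Γ X) {α : Γ}
    {A : Set (commutator Γ)} (hconf : IsConfining (MulAut.conjNormal α : MulAut (commutator Γ)) A)
    (hA : ∀ a ∈ A, a⁻¹ ∈ A) {x : X} (h : InclusionIsQuasiIsometry α A x) (c : ℝ) (hc : 0 ≤ c) :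
    ∃ B : ℝ, ∀ (W : ℕ → CyclicExtension (MulAut.conjNormal α : MulAut (commutator Γ))) (m : ℕ),
      (∀ i j, i ≤ j → wordDist (confiningGenerators (MulAut.conjNormal α) A) (W i) (W j) ≤
        (j : ℝ) - i) →
      (m : ℝ) - c ≤ wordDist (confiningGenerators (MulAut.conjNormal α) A) (W 0) (W m) →
      ∀ p ≤ m, dist (commutatorExtensionHom α (W 0) • x) (commutatorExtensionHom α (W p) • x) +
        dist (commutatorExtensionHom α (W p) • x) (commutatorExtensionHom α (W m) • x) ≤
        dist (commutatorExtensionHom α (W 0) • x) (commutatorExtensionHom α (W m) • x) + B := by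
  obtain ⟨C, hC, hup, hlow, R, hR0, hR⟩ := h.exists_bounds hcob
  obtain ⟨δ, hδ⟩ := hconf.fourPoint_wordDist hA
  have hd := hconf.wordGenerates.isPseudoDist
  set ι := commutatorExtensionHom α with hι
  set S := confiningGenerators (MulAut.conjNormal α : MulAut (commutator Γ)) A with hS
  obtain ⟨r₀, hr₀⟩ := exists_rough_geodesic_near_quasigeodesic hd hδ hδ.nonneg (c := c)
    (K := C * (2 * R + 1) + C * C) (lam := C + (2 * R + 2)) hc (by positivity)
  refine ⟨2 * (C * r₀ + C) + 2 * R, fun W m hW hm i hi => ?_⟩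
  obtain ⟨N, p, hp0, hpN, -, hstep, hquasi, hnear⟩ :=
    hgeod.exists_discrete_path (f := fun g => ι g • x) hR0 hR (W 0) (W m)
  -- Path steps are short and the total is nearly optimal, so every subpath is nearly optimal.
  have hrough : ∀ i j, i ≤ j → j ≤ m →
      ((j : ℝ) - i) - c ≤ wordDist S (W i) (W j) ∧ wordDist S (W i) (W j) ≤ ((j : ℝ) - i) + c := by
    intro i j hij hj
    have h1 := hW 0 i (Nat.zero_le _)
    have h2 := hW j m hj
    have h3 := hd.triangle (W 0) (W i) (W m)
    have h4 := hd.triangle (W i) (W j) (W m)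
    have h5 := hW i j hij
    push_cast at h1
    constructor <;> linarith
  have hstep' : ∀ k < N, wordDist S (p k) (p (k + 1)) ≤ C * (2 * R + 1) + C * C := by
    intro k hk
    have h1 := hlow (p k) (p (k + 1))
    have h2 := hstep k hk
    have h3 : C * dist (ι (p k) • x) (ι (p (k + 1)) • x) ≤ C * (2 * R + 1) := by gcongr
    linarith
  have hquasi' : ∀ k l, k ≤ l → l ≤ N → (l : ℝ) - k ≤
      (C + (2 * R + 2)) * wordDist S (p k) (p l) + (C + (2 * R + 2)) := by
    intro k l hkl hl
    have h1 := hquasi k l hkl hl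
    have h2 := hup (p k) (p l)
    have h3 := hd.nonneg (p k) (p l)
    have h4 : 0 ≤ (2 * R + 2) * wordDist S (p k) (p l) := by positivity
    linarith
  -- The stability lemma is applied in the group: the discretized geodesic of `X` is the
  -- quasigeodesic there, and `W` is the rough geodesic passing near it.
  obtain ⟨k, hk, hik⟩ := hr₀ W m p N hrough hstep' hquasi' hp0 hpN i hi
  have h1 := hnear k hk
  have h2 := hup (W i) (p k)
  have h3 : C * wordDist S (W i) (p k) ≤ C * r₀ := by gcongr
  have h4 := dist_triangle (ι (W 0) • x) (ι (p k) • x) (ι (W i) • x)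
  have h5 := dist_triangle (ι (W i) • x) (ι (p k) • x) (ι (W m) • x)
  rw [dist_comm (ι (p k) • x) (ι (W i) • x)] at h4
  linarith

theorem commutatorExtensionHom_power (α : Γ) (n : ℤ) :
    commutatorExtensionHom α (power (MulAut.conjNormal α : MulAut (commutator Γ)) n) = α ^ n := by
  rw [commutatorExtensionHom_apply]
  simp

theorem commutatorExtensionHom_base (α : Γ) (c : commutator Γ) :
    commutatorExtensionHom α (base (MulAut.conjNormal α : MulAut (commutator Γ)) c) = c := by
  rw [commutatorExtensionHom_apply]
  simp

theorem IsConfining.le_modelDist_power {H : Type*} [Group H] {φ : MulAut H} {A : Set H}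
    (h : IsConfining φ A) (n : ℕ) : (n : ℝ) ≤ modelDist A 1 (power φ (-n)) := by
  have h1 := (h.isLevel_level 1 (power φ (-n))).2.1
  rw [height_power, neg_neg] at h1
  have h2 : (n : ℝ) ≤ level A 1 (power φ (-n)) := by exact_mod_cast h1
  simp only [modelDist, height_one, height_power]
  push_cast
  linarith

/-- Up to rescaling, orbit maps of `[Γ, Γ] ⋊ ⟨α⟩` are at bounded distance from isometric
embeddings for the model distance. -/
theorem exists_abs_dist_sub_modelDist_le (hgeod : IsGeodesicSpace X)
    (hcob : IsCoboundedAction Γ X) {α : Γ} {A : Set (commutator Γ)}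
    (hconf : IsConfining (MulAut.conjNormal α : MulAut (commutator Γ)) A)
    (hA : ∀ a ∈ A, a⁻¹ ∈ A) {x : X} (h : InclusionIsQuasiIsometry α A x) :
    ∃ l C : ℝ, 0 < l ∧ (∀ n : ℕ, |dist x (α ^ n • x) - n * l| ≤ C) ∧
      ∀ g g' : CyclicExtension (MulAut.conjNormal α : MulAut (commutator Γ)),
        |dist (commutatorExtensionHom α g • x) (commutatorExtensionHom α g' • x) -
          l * modelDist A g g'| ≤ C := by
  obtain ⟨C, hC, hup, hlow, -⟩ := h.exists_bounds hcob
  obtain ⟨c, hc⟩ := hconf.exists_modelDist_le hA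
  obtain ⟨B, hB⟩ := exists_dist_add_le hgeod hcob hconf hA h (|c| + 1) (by positivity)
  have hcc := le_abs_self c
  set φ : MulAut (commutator Γ) := MulAut.conjNormal α with hφ
  set ι := commutatorExtensionHom α with hι
  set S := confiningGenerators φ A with hS
  set a : ℕ → ℝ := fun n => dist x (α ^ n • x) with ha
  have hιp : ∀ n : ℤ, ι (power φ n) = α ^ n := commutatorExtensionHom_power α
  have hpow : ∀ n : ℕ, dist x (ι (power φ (-n)) • x) = a n := by
    intro n
    rw [hιp, zpow_neg, dist_inv_smul, zpow_natCast]
  have hsub : ∀ m n, a (m + n) ≤ a m + a n := by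
    intro m n
    have := dist_triangle x (α ^ m • x) (α ^ (m + n) • x)
    rwa [pow_add, mul_smul, dist_smul, ← mul_smul, ← pow_add] at this
  have hsuper : ∀ m n, a m + a n ≤ a (m + n) + B := by
    intro m n
    have h1 := hB (fun p => power φ (-p)) (m + n) (fun i j hij => ?_) ?_ m (by omega)
    · have h2 : dist (ι (power φ (-(m : ℕ))) • x) (ι (power φ (-(m + n : ℕ))) • x) = a n := by
        rw [← hpow, ← dist_smul (ι (power φ (-(m : ℕ)))) x, ← mul_smul, ← map_mul, ← power_add]
        congr 4
        push_cast; ring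
      rw [h2, Nat.cast_zero, neg_zero, power_zero, map_one, one_smul, hpow, hpow] at h1
      exact h1
    · refine wordDist_le_of_path hconf.wordGenerates (p := fun p : ℕ => power φ (-p))
        (fun k => ⟨_, power_neg_one_mem_confiningGenerators, ?_⟩) hij
      rw [← power_add]
      push_cast
      congr 1; ring
    · have h1 := hc 1 (power φ (-(m + n : ℕ)))
      have h2 := hconf.le_modelDist_power (m + n)
      rw [Nat.cast_zero, neg_zero, power_zero]
      linarith
  have hB0 : 0 ≤ B := by linarith [hsub 0 0, hsuper 0 0]
  obtain ⟨l, hl⟩ := exists_slope_of_quasiAdditive (q := a) (C := B) fun m n => by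
    have := hsub m n
    have := hsuper m n
    rw [abs_le]
    constructor <;> linarith
  -- If `l ≤ 0`, the displacement of `x` by `α ^ n` would stay at most `B`, whereas the word length
  -- of `α ^ (-n)` is at least `n - c`.
  have hl0 : 0 < l := by
    by_contra! hneg
    obtain ⟨n, hn⟩ := exists_nat_gt (|c| + C * B + C * C)
    have h1 := hlow 1 (power φ (-n))
    have h2 := hc 1 (power φ (-n))
    have h3 := hconf.le_modelDist_power n
    have h4 := (abs_le.1 (hl n)).2
    rw [map_one, one_smul, hpow] at h1
    have h5 : (n : ℝ) * l ≤ 0 := mul_nonpos_of_nonneg_of_nonpos (by positivity) hneg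
    have h6 : C * a n ≤ C * B := by gcongr; linarith
    linarith
  refine ⟨l, 2 * C + 3 * B, hl0, fun n => (hl n).trans (by linarith), ?_⟩
  suffices hmain : ∀ g : CyclicExtension φ,
      |dist x (ι g • x) - l * modelDist A 1 g| ≤ 2 * C + 3 * B by
    intro g g'
    have := hmain (g⁻¹ * g')
    rwa [map_mul, map_inv, mul_smul, ← dist_smul (ι g), smul_inv_smul,
      ← hconf.modelDist_mul_left g, mul_one, mul_inv_cancel_left] at this
  intro g
  -- Almost additivity at the top of the up-across-down path reduces the distance to the
  -- displacements of `α ^ i` and `α ^ j`. The error is `2 * C` for the letter `b`, and `B` for each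
  -- of the splitting and the two slopes.
  obtain ⟨i, j, b, hb, hi, hj, e⟩ := (hconf.isLevel_level 1 g).exists_eq
  have hD : modelDist A 1 g = i + j := by
    simp only [modelDist, height_one]
    exact_mod_cast (by omega : 0 + height g + 2 * level A 1 g = i + j)
  have hbx : dist x (ι (base φ b) • x) ≤ 2 * C := by
    have h1 := hup 1 (1 * base φ b)
    have h2 := wordDist_le_one (base_mem_confiningGenerators (α := φ) hb) 1
    rw [one_mul] at h1 h2
    rw [map_one, one_smul] at h1
    have h3 : C * wordDist S 1 (base φ b) ≤ C * 1 := by gcongr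
    linarith
  have hg : dist (ι (power φ (-i)) • x) (ι g • x) = dist x (ι (base φ b) • α ^ j • x) := by
    rw [e, map_mul, map_mul, mul_smul, mul_smul, dist_smul, hιp j, zpow_natCast]
  have h1 := hB (verticalPath φ b i) (i + j + 1)
    (fun p q hpq => wordDist_le_of_path hconf.wordGenerates (exists_mem_verticalPath_succ hb i) hpq)
    (by
      have h1 := hc 1 g
      rw [verticalPath_zero, verticalPath_end, ← e]
      push_cast
      linarith) i (by omega)
  rw [verticalPath_zero, verticalPath_end, verticalPath_top, ← e, map_one, one_smul, hpow, hg] at h1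
  have h2 := dist_triangle x (ι (power φ (-i)) • x) (ι g • x)
  rw [hpow, hg] at h2
  have h3 := dist_triangle x (ι (base φ b) • x) (ι (base φ b) • α ^ j • x)
  have h4 := dist_triangle (ι (base φ b) • x) x (ι (base φ b) • α ^ j • x)
  rw [dist_smul] at h3 h4
  rw [dist_comm _ x] at h4
  have h5 := abs_le.1 (hl i)
  have h6 := abs_le.1 (hl j)
  simp only [ha] at *
  rw [hD, abs_le]
  constructor <;> linarith

theorem fourPoint_of_inclusionIsQuasiIsometry (hgeod : IsGeodesicSpace X)
    (hcob : IsCoboundedAction Γ X) {α : Γ} {A : Set (commutator Γ)}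
    (hconf : IsConfining (MulAut.conjNormal α : MulAut (commutator Γ)) A)
    (hA : ∀ a ∈ A, a⁻¹ ∈ A) {x : X} (h : InclusionIsQuasiIsometry α A x) :
    ∃ δ : ℝ, FourPoint (dist : X → X → ℝ) δ := by
  obtain ⟨l, C, hl, -, hC⟩ := exists_abs_dist_sub_modelDist_le hgeod hcob hconf hA h
  obtain ⟨-, -, -, -, R, -, hR⟩ := h.exists_bounds hcob
  obtain ⟨δ, hδ⟩ := hconf.fourPoint_modelDist hA
  choose f hf using hR
  refine ⟨_, (hδ.const_mul hl.le).of_abs_sub_le f (C := C + 2 * R) fun y y' => ?_⟩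
  have h1 := abs_le.1 (hC (f y) (f y'))
  have h2 := dist_triangle4 (commutatorExtensionHom α (f y) • x) y y'
    (commutatorExtensionHom α (f y') • x)
  have h3 := dist_triangle4 y (commutatorExtensionHom α (f y) • x)
    (commutatorExtensionHom α (f y') • x) y'
  have h4 := hf y
  have h5 := hf y'
  rw [dist_comm y' (commutatorExtensionHom α (f y') • x)] at h2
  rw [dist_comm y (commutatorExtensionHom α (f y) • x)] at h3
  rw [abs_le]
  constructor <;> linarith

/-- The commutators of `g` with the powers of `α` stay in a bounded region. -/
theorem IsConfining.exists_commutator_mem {α : Γ} {A : Set (commutator Γ)}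
    (hconf : IsConfining (MulAut.conjNormal α : MulAut (commutator Γ)) A) (g : Γ) :
    ∃ m : ℕ, ∀ n : ℕ, ((MulAut.conjNormal α : MulAut (commutator Γ)) ^ m)
      ⟨α ^ n * g * (α ^ n)⁻¹ * g⁻¹, commutator_of_conj g (α ^ n)⟩ ∈ A := by
  set φ : MulAut (commutator Γ) := MulAut.conjNormal α with hφ
  set c : ℕ → commutator Γ :=
    fun n => ⟨α ^ n * g * (α ^ n)⁻¹ * g⁻¹, commutator_of_conj g (α ^ n)⟩ with hc
  -- Positivity makes the induction in steps of `n₀` well founded.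
  obtain ⟨n₀, hn₀⟩ : ∃ n₀ : ℕ, 0 < n₀ ∧ ∀ a ∈ A, ∀ b ∈ A, (φ ^ n₀) (a * b) ∈ A := by
    obtain ⟨n₀, hn₀⟩ := hconf.2.2
    refine ⟨n₀ + 1, by omega, fun a ha b hb => ?_⟩
    rw [pow_succ', MulAut.mul_apply]
    exact hconf.1 ⟨_, hn₀ a ha b hb, rfl⟩
  have hmono : ∀ {k m : ℕ} {d : commutator Γ}, k ≤ m → (φ ^ k) d ∈ A → (φ ^ m) d ∈ A := by
    intro k m d hkm hd
    obtain ⟨i, rfl⟩ := Nat.exists_eq_add_of_le hkm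
    rw [add_comm, pow_add, MulAut.mul_apply]
    exact hconf.pow_mem hd i
  choose k hk using fun n => hconf.2.1 (c n)
  set m₀ := (Finset.range (n₀ + 1)).sup k with hm₀
  have hm : ∀ n ≤ n₀, (φ ^ m₀) (c n) ∈ A := fun n hn =>
    hmono (Finset.le_sup (f := k) (Finset.mem_range.2 (by omega))) (hk n)
  -- In this cocycle identity, the `φ ^ n₀` on the first factor compensates exactly the `n₀` lost in
  -- taking a product, so the exponent `m₀ + n₀` works for all `n`.
  have hrec : ∀ n, c (n + n₀) = (φ ^ n₀) (c n) * c n₀ := by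
    intro n
    ext
    rw [Subgroup.coe_mul, hφ, conjNormal_pow_apply]
    simp only [hc]
    rw [add_comm, pow_add]
    group
  refine ⟨m₀ + n₀, fun n => ?_⟩
  change (φ ^ (m₀ + n₀)) (c n) ∈ A
  induction n using Nat.strong_induction_on with
  | _ n ih =>
    rcases Nat.lt_or_ge n n₀ with hn | hn
    · exact hmono (by omega) (hm n hn.le)
    · obtain ⟨n', rfl⟩ := Nat.exists_eq_add_of_le' hn
      have h1 := ih n' (by omega)
      rw [hrec, add_comm m₀, pow_add, MulAut.mul_apply, map_mul (φ ^ m₀)]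
      refine hn₀.2 _ ?_ _ (hm n₀ le_rfl)
      rwa [← MulAut.mul_apply, ← pow_add]

/-- Otherwise surjectivity of `φ ^ k` makes `A` everything, and then `φ '' A = A`. This is how
strictness yields unbounded orbits. -/
theorem IsStrictlyConfining.exists_notMem {H : Type*} [Group H] {φ : MulAut H} {A : Set H}
    (h : IsStrictlyConfining φ A) (k : ℕ) : ∃ c : H, (φ ^ k) c ∉ A := by
  by_contra! hall
  have hA : A = Set.univ := by
    refine Set.eq_univ_of_forall fun c => ?_
    have := hall ((φ ^ k)⁻¹ c)
    rwa [MulAut.apply_inv_self] at this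
  refine h.2 ?_
  rw [hA, Set.image_univ]
  exact φ.surjective.range_eq

theorem exists_isFocalAt_of_isConfiningPair [Nonempty X] (hgeod : IsGeodesicSpace X)
    (hcob : IsCoboundedAction Γ X) {α : Γ} {A : Set (commutator Γ)} (h : IsConfiningPair X α A)
    {δ : ℝ} (hX : FourPoint (dist : X → X → ℝ) δ) :
    IsHyperbolicIsometry X α ∧ ∃ ξ : VisualBoundary X, IsFocalAt Γ ξ ∧
      ∃ β : Γ → ℝ, IsBusemannQuasicharacter ξ β ∧ ∀ g g' : Γ, β (g * g') = β g + β g' := by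
  obtain ⟨-, hA, hstrict, x, hqi⟩ := h
  have hconf := hstrict.1
  obtain ⟨l, C, hl, hC, hD⟩ := exists_abs_dist_sub_modelDist_le hgeod hcob hconf hA hqi
  have hC0 : 0 ≤ C := (abs_nonneg _).trans (hC 0)
  set φ : MulAut (commutator Γ) := MulAut.conjNormal α with hφ
  have hδ := hX.nonneg
  have hbase : ∀ c : commutator Γ,
      |dist x ((c : Γ) • x) - l * (2 * level A 1 (base φ c))| ≤ C := by
    intro c
    have := hD 1 (base φ c)
    rw [map_one, one_smul, show commutatorExtensionHom α (base φ c) = c from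
      commutatorExtensionHom_base α c] at this
    have hh : height (base φ c) = 0 := rfl
    simpa [modelDist, hh] using this
  have hmem : ∀ (c : commutator Γ) (m : ℕ), (φ ^ m) c ∈ A → dist x ((c : Γ) • x) ≤ l * (2 * m) + C := by
    intro c m hm
    have h1 : level A 1 (base φ c) ≤ m := level_le ⟨by simp, by simp, by simpa using hm⟩
    have h2 : (level A 1 (base φ c) : ℝ) ≤ m := by exact_mod_cast h1
    have h3 := (abs_le.1 (hbase c)).2
    have h4 : l * (2 * level A 1 (base φ c)) ≤ l * (2 * m) := by gcongr
    linarith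
  have hunbdd : ∀ R : ℝ, ∃ c : commutator Γ, R < dist x ((c : Γ) • x) := by
    intro R
    by_contra! hR
    obtain ⟨k, hk⟩ := exists_nat_ge ((R + C) / (l * 2))
    rw [div_le_iff₀ (by positivity)] at hk
    obtain ⟨c, hc⟩ := hstrict.exists_notMem k
    refine hc ?_
    have h1 := (abs_le.1 (hbase c)).1
    have h2 := hR c
    have h3 : (level A 1 (base φ c) : ℝ) ≤ k := by
      have : (l * 2) * (level A 1 (base φ c) : ℝ) ≤ (l * 2) * k := by linarith
      exact le_of_mul_le_mul_left this (by positivity)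
    have h4 := (hconf.isLevel_mono (by exact_mod_cast h3)
      (hconf.isLevel_level 1 (base φ c)) : IsLevel A 1 (base φ c) k).2.2
    simpa using h4
  have hhyp : IsHyperbolicIsometry X α := by
    refine ⟨l, hl, fun y => tendsto_div_of_abs_sub_le (C := C + 2 * dist x y) fun n => ?_⟩
    have h1 := dist_triangle4 y x (α ^ n • x) (α ^ n • y)
    have h2 := dist_triangle4 x y (α ^ n • y) (α ^ n • x)
    rw [dist_smul] at h1 h2
    rw [dist_comm y x] at h1 h2
    have h3 := abs_le.1 (hC n)
    rw [abs_le]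
    constructor <;> linarith
  refine ⟨hhyp, ?_⟩
  set u : ℕ → X := fun n => (α ^ n)⁻¹ • x with hu
  have hux : ∀ n : ℕ, n * l - C ≤ dist x (u n) := by
    intro n
    have := (abs_le.1 (hC n)).1
    simp only [hu]
    rw [dist_inv_smul]
    linarith
  have huu : ∀ n m : ℕ, n ≤ m → dist (u n) (u m) ≤ ((m : ℝ) - n) * l + C := by
    intro n m hnm
    obtain ⟨k, rfl⟩ := Nat.exists_eq_add_of_le hnm
    have h1 := (abs_le.1 (hC k)).2
    have h2 : dist (u n) (u (n + k)) = dist x (α ^ k • x) := by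
      simp only [hu]
      rw [pow_add, (Commute.pow_pow_self α n k).eq, mul_inv_rev, mul_smul,
        dist_smul, dist_inv_smul]
    rw [h2]
    push_cast
    linarith
  have huC : IsCauchyGromov u := isCauchyGromov_of_linear hl hux huu
  obtain ⟨ξ, hξ⟩ : ∃ ξ : VisualBoundary X, Quot.mk (CauchyGromovRel X) ⟨u, huC⟩ = ξ := ⟨_, rfl⟩
  have hfix : ∀ g : Γ, g • ξ = ξ := by
    intro g
    rw [← hξ]
    obtain ⟨m, hm⟩ := hconf.exists_commutator_mem g
    refine smul_mk_eq_of_bounded hX hl hux huC (F := l * (2 * m) + C + dist x (g • x)) fun n => ?_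
    have h1 := hmem _ m (hm n)
    have h4 : dist (g • u n) (u n) = dist x ((α ^ n * g * (α ^ n)⁻¹ * g⁻¹) • g • x) := by
      rw [dist_comm, ← dist_smul (α ^ n)]
      simp only [hu, smul_smul, mul_inv_cancel, one_smul]
      congr 2
      group
    have h5 := dist_triangle x ((α ^ n * g * (α ^ n)⁻¹ * g⁻¹) • x)
      ((α ^ n * g * (α ^ n)⁻¹ * g⁻¹) • g • x)
    rw [dist_smul] at h5
    simp only at h1
    linarith
  -- For `n` large, `α ^ n` conjugates `c` into `A`. The bound `C` does not depend on `c`; only the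
  -- rank does.
  have hcomm : ∀ c ∈ commutator Γ, ∀ᶠ n in atTop, dist (u n) (c • u n) ≤ C := by
    intro c hc
    obtain ⟨k, hk⟩ := hconf.2.1 ⟨c, hc⟩
    filter_upwards [eventually_ge_atTop k] with n hn
    obtain ⟨i, rfl⟩ := Nat.exists_eq_add_of_le' hn
    have h1 := hconf.pow_mem hk i
    rw [← MulAut.mul_apply, ← pow_add] at h1
    have h2 := hmem ((φ ^ (i + k)) ⟨c, hc⟩) 0 (by simpa using h1)
    rw [dist_conjNormal_pow_smul] at h2
    simpa using h2
  obtain ⟨β, hβ⟩ := exists_isBusemannQuasicharacter hX hfix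
  refine ⟨ξ, ⟨hfix, fun η hη => ?_, α, hhyp⟩, β, hβ, ?_⟩
  · obtain ⟨v, hv⟩ := Quot.exists_rep η
    by_contra hne
    have hrel : ¬ CauchyGromovRel X ⟨u, huC⟩ v := fun hrel =>
      hne (by rw [← hv, ← hξ]; exact ((visualBoundary_mk_eq_iff hX).2 hrel).symm)
    obtain ⟨T, N, hT⟩ : ∃ (T : ℝ) (N : ℕ), ∀ n ≥ N, ∀ m ≥ N,
        gromovProduct dist x (u n) (v.1 m) < T := by
      by_contra! hcon
      exact hrel (cauchyGromovRel_of_frequently hX x hcon)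
    -- If `c` fixes `η`, both `x` and `c • x` are near a line from `u n` to `v n`, and at nearly the
    -- same distance from `u n` because `c` almost fixes `u n`. So `c` moves `x` by a bounded
    -- amount, contrary to this choice.
    obtain ⟨c, hc⟩ := hunbdd (2 * (|T| + δ + C) + C + 2 * δ)
    have hv' : CauchyGromovRel X ⟨fun n => (c : Γ)⁻¹ • v.1 n, v.2.smul _⟩ v := by
      refine (visualBoundary_mk_eq_iff hX).1 ?_
      have := hη (c : Γ)⁻¹
      rw [← hv] at this
      exact this
    obtain ⟨n, hn, hnN, hnv⟩ := ((hcomm c c.2).and ((eventually_ge_atTop N).and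
      (tendsto_atTop.1 (hv' x) (T + δ)))).exists
    simp only at hnv
    have h1 := hT n hnN n hnN
    have h2 := hX x (u n) ((c : Γ)⁻¹ • v.1 n) (v.1 n)
    have h3 : gromovProduct dist x (u n) ((c : Γ)⁻¹ • v.1 n) ≤ T + δ := by
      by_contra! hlt
      have := le_min hlt.le hnv
      linarith
    have e1 : dist (u n) ((c : Γ)⁻¹ • v.1 n) = dist ((c : Γ) • u n) (v.1 n) := by
      rw [← dist_smul (c : Γ), smul_inv_smul]
    have e2 : dist x ((c : Γ)⁻¹ • v.1 n) = dist ((c : Γ) • x) (v.1 n) := by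
      rw [← dist_smul (c : Γ), smul_inv_smul]
    have e3 : dist x (u n) = dist ((c : Γ) • x) ((c : Γ) • u n) := (dist_smul _ _ _).symm
    simp only [gromovProduct, e1, e2] at h1 h3
    have e4 := dist_triangle ((c : Γ) • x) (u n) ((c : Γ) • u n)
    have e5 := dist_triangle ((c : Γ) • x) ((c : Γ) • u n) (u n)
    have e6 := dist_triangle ((c : Γ) • u n) (u n) (v.1 n)
    rw [dist_comm ((c : Γ) • u n) (u n)] at e5 e6
    have e7 := hX.le_max (u n) x (v.1 n) ((c : Γ) • x)
    rw [dist_comm (u n) ((c : Γ) • x), dist_comm (u n) x, dist_comm (v.1 n) ((c : Γ) • x)] at e7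
    have e8 := le_abs_self T
    have e9 := abs_nonneg T
    rcases max_cases (dist x (v.1 n) + dist ((c : Γ) • x) (u n))
      (dist x (u n) + dist ((c : Γ) • x) (v.1 n)) with ⟨e, -⟩ | ⟨e, -⟩ <;> rw [e] at e7 <;> linarith
  · obtain ⟨k, hk⟩ := horokernels_nonempty ξ
    have H := isQuasiHorofunction_of_mem_horokernels hX hfix hk
    -- Since `c` moves far points `u n` by at most `C`, the difference `dist x (u n) - dist (c • x)
    -- (u n)` is at most `C` in absolute value.
    refine H.map_mul (x := x) (fun g n => H.abs_sub_le_of_tendsto (hβ k hk x g) n)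
      (B := C + 2 * δ) fun c hc => ?_
    obtain ⟨n, h1, h2⟩ := ((hcomm c hc).and
      (eventually_abs_sub_horokernel_le hX hk hξ x (c • x))).exists
    have e1 : dist x (u n) = dist (c • x) (c • u n) := (dist_smul _ _ _).symm
    have e2 := dist_triangle (c • x) (u n) (c • u n)
    have e3 := dist_triangle (c • x) (c • u n) (u n)
    rw [dist_comm (c • u n) (u n)] at e3
    rw [abs_le] at *
    simp only at h2
    constructor <;> linarith

end Converse

theorem theorem4 {Γ : Type u} [Group Γ] {X : Type v} [MetricSpace X] [Nonempty X]
    [MulAction Γ X] [IsIsometricSMul Γ X]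
    (hgeod : IsGeodesicSpace X) (hcob : IsCoboundedAction Γ X) :
    ((IsGromovHyperbolic (dist : X → X → ℝ) ∧ IsRegularFocal Γ X) ↔
      ∃ (α : Γ) (A : Set (commutator Γ)), IsConfiningPair X α A) ∧
    (∀ (α : Γ) (A : Set (commutator Γ)), IsConfiningPair X α A →
      (∀ x : X, InclusionIsQuasiIsometry α A x) ∧
      ∀ (ξ : VisualBoundary X) (β : Γ → ℝ), IsFocalAt Γ ξ → IsBusemannQuasicharacter ξ β →
        ∃ c : ℝ, c ≠ 0 ∧ ∀ h ∈ commutator Γ, ∀ n : ℤ, β (h * α ^ n) = c * n) ∧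
    (∀ (H : Type w) [Group H] (α : MulAut H) (A : Set H),
      (∀ a ∈ A, a⁻¹ ∈ A) → IsConfining α A →
        IsGromovHyperbolic (wordDist (confiningGenerators α A))) := by
  have hhyp : ∀ (α : Γ) (A : Set (commutator Γ)), IsConfiningPair X α A →
      ∃ δ : ℝ, FourPoint (dist : X → X → ℝ) δ := fun α A h => by
    obtain ⟨-, hA, hstrict, x, hqi⟩ := h
    exact fourPoint_of_inclusionIsQuasiIsometry hgeod hcob hstrict.1 hA hqi
  refine ⟨⟨?_, ?_⟩, fun α A h => ⟨fun x => ?_, fun ξ β hξ hβ => ?_⟩, fun H _ α A hA hconf =>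
    hconf.fourPoint_wordDist hA⟩
  · rintro ⟨⟨δ, hX⟩, hreg⟩
    exact exists_isConfiningPair hgeod hcob hX hreg
  · rintro ⟨α, A, h⟩
    obtain ⟨δ, hX⟩ := hhyp α A h
    exact ⟨⟨δ, hX⟩, (exists_isFocalAt_of_isConfiningPair hgeod hcob h hX).2⟩
  · obtain ⟨-, -, -, y, hqi⟩ := h
    exact hqi.change_basepoint x
  · obtain ⟨δ, hX⟩ := hhyp α A h
    obtain ⟨hα, ξ', hξ', β', hβ', hmul⟩ := exists_isFocalAt_of_isConfiningPair hgeod hcob h hX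
    -- Uniqueness of the fixed point and of the quasicharacter identifies the given `β` with the
    -- additive one constructed; it is nonzero at `α`, a hyperbolic isometry.
    obtain rfl : ξ = ξ' := hξ'.2.1 ξ hξ.1
    obtain rfl : β = β' := hβ.eq hβ'
    obtain ⟨k, hk⟩ := horokernels_nonempty ξ
    have H := isQuasiHorofunction_of_mem_horokernels hX hξ.1 hk
    obtain ⟨x⟩ := ‹Nonempty X›
    refine ⟨β α, H.ne_zero_of_isHyperbolicIsometry hα x
      (H.abs_sub_le_of_tendsto (hβ k hk x α)), fun c hc n => ?_⟩
    rw [hmul, additive_commutator hmul hc, additive_zpow hmul, zero_add, mul_comm]
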